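/- Let $M_\perp\in\mathbb{R}^{m\times n}$, $b\in\mathbb{R}^m$, $\lambda>0$, and consider the $\ell_1$-penalized least-squares problem in slack form $$\min_{\beta,z,s_1,s_2}\ \tfrac12\|b-M_\perp\beta\|^2+\lambda e^\top z\quad\text{s.t.}\quad z+\beta-s_1=0,\ \ z-\beta-s_2=0,\ \ (s_1,s_2)\ge 0,$$ with variables in $\mathbb{R}^n$, multipliers $y=(y_1,y_2)$ for the equalities and $\nu=(\nu_1,\nu_2)$ for the bounds, and Lagrangian $$L=\tfrac12\|b-M_\perp\beta\|^2+\lambda e^\top z+y_1^\top(s_1-\beta-z)+y_2^\top(s_2-z+\beta)-\nu_1^\top s_1-\nu_2^\top s_2 .$$ Write $s=(s_1,s_2)$, and let $(\beta^\star,z^\star,s^\star,y^\star,\nu^\star)$ be a KKT point of this problem, i.e. $\nabla_{(\beta,z,s)}L=0$, the equality constraints hold, and $s^\star\ge0$, $\nu^\star\ge 0$, $s_1^{\star\top}\nu_1^\star=s_2^{\star\top}\nu_2^\star=0$. Assume strict complementarity, $s_i^\star+\nu_i^\star>0$ for all $2n$ indices $i$, and that $N_{\mathcal A}$, the submatrix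 of the columns of $M_\perp$ indexed by $\mathcal A=\{i:\beta^\star_i\ne 0\}$, has full column rank $|\mathcal A|$. Let $Q^\star=(M_\perp^\top M_\perp)_{\mathcal A\times\mathcal A}$. Let $C>0$ and $\gamma\in(0,1)$. For a point $w=(\beta,z,s,y,\nu)$ put $\mu(w)=\frac1{2n}(\nu_1^\top s_1+\nu_2^\top s_2)$, and let $\mathcal N(C,\gamma)$ be the set of all $w$ with, for $\mu=\mu(w)$, $$\|\nabla_{(\beta,z,s)}L\|\le C\mu,\quad \|z+\beta-s_1\|\le C\mu,\quad \|z-\beta-s_2\|\le C\mu,\quad (s,\nu)>0,\quad s_i\nu_i\ge\gamma\mu\ \ (i=1,\dots,2n).$$ For $w\in\mathcal N(C,\gamma)$ let $\Sigma_j=\operatorname{diag}(s_j)^{-1}\operatorname{diag}(\nu_j)$, $\Lambda_1=\Sigma_1+\Sigma_2$, $\Lambda_2=\Sigma_1-\Sigma_2$, $$K=\begin{bmatrix}M_\perp^\top M_\perp+\Lambda_1&\Lambda_2\\ \Lambda_2&\Lambda_1\end{bmatrix},\qquad P=\begin{bmatrix}I+\Lambda_1&\Lambda_2\\ \Lambda_2&\Lambda_1\end{bmatrix}.$$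 Then all eigenvalues of $P^{-1}K$ are real and positive, and the spectral condition number $\kappa(w)=\lambda_{\max}(P^{-1}K)/\lambda_{\min}(P^{-1}K)$ satisfies $$\lim_{\mu(w)\to0^+,\ w\in\mathcal N(C,\gamma)}\kappa(w)=\frac{\max\{1,\lambda_{\max}(Q^\star)\}}{\min\{1,\lambda_{\min}(Q^\star)\}}$$ (if $\beta^\star=0$, so that $Q^\star$ is empty, the right-hand side is read as $1$). Hence $\kappa$ is bounded on the neighborhood: there is $\bar\mu>0$ such that $\kappa$ is bounded on $\{w\in\mathcal N(C,\gamma):\mu(w)\le\bar\mu\}$, and for every $R$ it is bounded on $\{w\in\mathcal N(C,\gamma):\|s_1\|\le R,\ \|s_2\|\le R\}$, with no restriction on $\mu(w)$. -/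

import Mathlib

open Matrix Filter Topology

noncomputable section

namespace CompressedSensing

/-- A primal-dual point `(β, z, s, y, ν)` with `s = (s₁, s₂)`, `y = (y₁, y₂)`, `ν = (ν₁, ν₂)`, for
`min ½‖b - M β‖² + lam * ∑ zᵢ` subject to `z + β - s₁ = 0`, `z - β - s₂ = 0`, `(s₁, s₂) ≥ 0`. -/
structure Iterate (n : ℕ) where
  β : Fin n → ℝ
  z : Fin n → ℝ
  s₁ : Fin n → ℝ
  s₂ : Fin n → ℝ
  y₁ : Fin n → ℝ
  y₂ : Fin n → ℝ
  ν₁ : Fin n → ℝ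
  ν₂ : Fin n → ℝ

/-- The Euclidean norm of a finite real vector. -/
def euclNorm {ι : Type*} [Fintype ι] (x : ι → ℝ) : ℝ := Real.sqrt (∑ i, x i ^ 2)

/-- The gradient in `(β, z, s₁, s₂)`, a vector of `ℝ⁴ⁿ`, of the Lagrangian
`½‖b - M β‖² + lam * ∑ zᵢ + y₁ᵀ(s₁ - β - z) + y₂ᵀ(s₂ - z + β) - ν₁ᵀ s₁ - ν₂ᵀ s₂`. -/
def gradLagrangian {m n : ℕ} (M : Matrix (Fin m) (Fin n) ℝ) (b : Fin m → ℝ) (lam : ℝ)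
    (w : Iterate n) : Fin n ⊕ (Fin n ⊕ (Fin n ⊕ Fin n)) → ℝ :=
  Sum.elim (Mᵀ *ᵥ (M *ᵥ w.β - b) - w.y₁ + w.y₂)
    (Sum.elim ((fun _ => lam) - w.y₁ - w.y₂)
      (Sum.elim (w.y₁ - w.ν₁) (w.y₂ - w.ν₂)))

/-- The Karush-Kuhn-Tucker conditions. -/
structure IsKKT {m n : ℕ} (M : Matrix (Fin m) (Fin n) ℝ) (b : Fin m → ℝ) (lam : ℝ)
    (w : Iterate n) : Prop where
  stationary_β : Mᵀ *ᵥ (M *ᵥ w.β - b) - w.y₁ + w.y₂ = 0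
  stationary_z : ∀ i, lam - w.y₁ i - w.y₂ i = 0
  stationary_s₁ : w.y₁ - w.ν₁ = 0
  stationary_s₂ : w.y₂ - w.ν₂ = 0
  feasible₁ : w.z + w.β - w.s₁ = 0
  feasible₂ : w.z - w.β - w.s₂ = 0
  s₁_nonneg : ∀ i, 0 ≤ w.s₁ i
  s₂_nonneg : ∀ i, 0 ≤ w.s₂ i
  ν₁_nonneg : ∀ i, 0 ≤ w.ν₁ i
  ν₂_nonneg : ∀ i, 0 ≤ w.ν₂ i
  compl₁ : w.s₁ ⬝ᵥ w.ν₁ = 0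
  compl₂ : w.s₂ ⬝ᵥ w.ν₂ = 0

/-- Strict complementarity: `sᵢ + νᵢ > 0` for all `2n` indices. -/
def StrictComplementarity {n : ℕ} (w : Iterate n) : Prop :=
  ∀ i, 0 < w.s₁ i + w.ν₁ i ∧ 0 < w.s₂ i + w.ν₂ i

/-- The duality measure `μ = (ν₁ᵀ s₁ + ν₂ᵀ s₂) / (2n)`. -/
def dualityMeasure {n : ℕ} (w : Iterate n) : ℝ :=
  (w.ν₁ ⬝ᵥ w.s₁ + w.ν₂ ⬝ᵥ w.s₂) / (2 * (n : ℝ))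

/-- The points that satisfy the centrality conditions with parameters `C` and `γ`: the "large"
(infeasible) neighborhood of the central path. -/
def centralNbhd {m n : ℕ} (M : Matrix (Fin m) (Fin n) ℝ) (b : Fin m → ℝ) (lam C γ : ℝ) :
    Set (Iterate n) :=
  {w | euclNorm (gradLagrangian M b lam w) ≤ C * dualityMeasure w ∧
    euclNorm (w.z + w.β - w.s₁) ≤ C * dualityMeasure w ∧
    euclNorm (w.z - w.β - w.s₂) ≤ C * dualityMeasure w ∧
    (∀ i, 0 < w.s₁ i ∧ 0 < w.s₂ i ∧ 0 < w.ν₁ i ∧ 0 < w.ν₂ i) ∧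
    ∀ i, γ * dualityMeasure w ≤ w.s₁ i * w.ν₁ i ∧ γ * dualityMeasure w ≤ w.s₂ i * w.ν₂ i}

/-- `Σ₁ = S₁⁻¹ V₁`. -/
def sigma₁ {n : ℕ} (w : Iterate n) : Matrix (Fin n) (Fin n) ℝ :=
  diagonal fun i => (w.s₁ i)⁻¹ * w.ν₁ i

/-- `Σ₂ = S₂⁻¹ V₂`. -/
def sigma₂ {n : ℕ} (w : Iterate n) : Matrix (Fin n) (Fin n) ℝ :=
  diagonal fun i => (w.s₂ i)⁻¹ * w.ν₂ i

/-- `Λ₁ = Σ₁ + Σ₂`. -/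
def Lambda₁ {n : ℕ} (w : Iterate n) : Matrix (Fin n) (Fin n) ℝ := sigma₁ w + sigma₂ w

/-- `Λ₂ = Σ₁ - Σ₂`. -/
def Lambda₂ {n : ℕ} (w : Iterate n) : Matrix (Fin n) (Fin n) ℝ := sigma₁ w - sigma₂ w

/-- The condensed KKT matrix. -/
def condensedKKT {m n : ℕ} (M : Matrix (Fin m) (Fin n) ℝ) (w : Iterate n) :
    Matrix (Fin n ⊕ Fin n) (Fin n ⊕ Fin n) ℝ :=
  fromBlocks (Mᵀ * M + Lambda₁ w) (Lambda₂ w) (Lambda₂ w) (Lambda₁ w)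

/-- The preconditioner. -/
def preconditioner {n : ℕ} (w : Iterate n) : Matrix (Fin n ⊕ Fin n) (Fin n ⊕ Fin n) ℝ :=
  fromBlocks (1 + Lambda₁ w) (Lambda₂ w) (Lambda₂ w) (Lambda₁ w)

/-- The preconditioned matrix `P⁻¹ K`. -/
def preconditionedKKT {m n : ℕ} (M : Matrix (Fin m) (Fin n) ℝ) (w : Iterate n) :
    Matrix (Fin n ⊕ Fin n) (Fin n ⊕ Fin n) ℝ :=
  (preconditioner w)⁻¹ * condensedKKT M w

/-- The largest real eigenvalue of a square matrix. -/
def lambdaMax {ι : Type*} [Fintype ι] [DecidableEq ι] (A : Matrix ι ι ℝ) : ℝ :=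
  sSup (spectrum ℝ A)

/-- The smallest real eigenvalue of a square matrix. -/
def lambdaMin {ι : Type*} [Fintype ι] [DecidableEq ι] (A : Matrix ι ι ℝ) : ℝ :=
  sInf (spectrum ℝ A)

/-- The spectral condition number `λ_max / λ_min`, for matrices with real positive spectrum. -/
def spectralCond {ι : Type*} [Fintype ι] [DecidableEq ι] (A : Matrix ι ι ℝ) : ℝ :=
  lambdaMax A / lambdaMin A

/-- The set of active variables: the support of `β`. -/
def activeSet {n : ℕ} (β : Fin n → ℝ) : Finset (Fin n) :=
  Finset.univ.filter fun i => 0 < |β i|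

/-- The active submatrix: the columns of `M` in the support of `β`. -/
def activeSubmatrix {m n : ℕ} (M : Matrix (Fin m) (Fin n) ℝ) (β : Fin n → ℝ) :
    Matrix (Fin m) (activeSet β) ℝ :=
  M.submatrix id Subtype.val

/-- The principal submatrix of `Mᵀ M` on the support of `β`. -/
def activeGram {m n : ℕ} (M : Matrix (Fin m) (Fin n) ℝ) (β : Fin n → ℝ) :
    Matrix (activeSet β) (activeSet β) ℝ :=
  (Mᵀ * M).submatrix Subtype.val Subtype.val

end CompressedSensing

end

noncomputable section

namespace CompressedSensing

section Spectrum

variable {ι : Type*} [Fintype ι] [DecidableEq ι]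

lemma mem_spectrum_iff_exists_mulVec_eq_smul {𝕜 : Type*} [Field 𝕜] {A : Matrix ι ι 𝕜} {r : 𝕜} :
    r ∈ spectrum 𝕜 A ↔ ∃ v : ι → 𝕜, v ≠ 0 ∧ A *ᵥ v = r • v := by
  rw [← Matrix.spectrum_toLin', ← Module.End.hasEigenvalue_iff_mem_spectrum]
  constructor
  · intro h
    obtain ⟨v, hv⟩ := h.exists_hasEigenvector
    exact ⟨v, hv.2, by simpa using hv.apply_eq_smul⟩
  · rintro ⟨v, hv0, hv⟩
    exact Module.End.hasEigenvalue_of_hasEigenvector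
      ⟨Module.End.mem_eigenspace_iff.2 (by simpa using hv), hv0⟩

lemma mem_spectrum_inv_mul_iff {P K : Matrix ι ι ℝ} (hP : P.PosDef) {r : ℝ} :
    r ∈ spectrum ℝ (P⁻¹ * K) ↔ ∃ v : ι → ℝ, v ≠ 0 ∧ K *ᵥ v = r • P *ᵥ v := by
  have hdet : IsUnit P.det := (Matrix.isUnit_iff_isUnit_det _).1 hP.isUnit
  rw [mem_spectrum_iff_exists_mulVec_eq_smul]
  refine exists_congr fun v => and_congr_right fun _ => ⟨fun h => ?_, fun h => ?_⟩
  · have := congrArg (P *ᵥ ·) h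
    simpa [Matrix.mulVec_mulVec, ← Matrix.mul_assoc, Matrix.mul_nonsing_inv _ hdet,
      Matrix.mulVec_smul] using this
  · rw [← Matrix.mulVec_mulVec, h, Matrix.mulVec_smul, Matrix.mulVec_mulVec,
      Matrix.nonsing_inv_mul _ hdet, Matrix.one_mulVec]

lemma quadForm_le_of_spectrum_le {H : Matrix ι ι ℝ} (hH : H.IsHermitian) {c : ℝ}
    (h : ∀ r ∈ spectrum ℝ H, r ≤ c) (v : ι → ℝ) : v ⬝ᵥ H *ᵥ v ≤ c * (v ⬝ᵥ v) := by
  have hps : (algebraMap ℝ (Matrix ι ι ℝ) c - H).PosSemidef := by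
    rw [posSemidef_iff_isHermitian_and_spectrum_nonneg]
    refine ⟨.sub ?_ hH, ?_⟩
    · rw [Matrix.algebraMap_eq_diagonal]; exact isHermitian_diagonal _
    · rw [← spectrum.singleton_sub_eq]
      rintro _ ⟨_, rfl, r, hr, rfl⟩
      simpa using h r hr
  have := hps.dotProduct_mulVec_nonneg v
  simpa [Matrix.sub_mulVec, dotProduct_sub, Algebra.algebraMap_eq_smul_one, smul_mulVec] using this

/-- Rayleigh quotient bound for a symmetric-definite pencil. -/
lemma forall_mem_spectrum_le_iff {P K : Matrix ι ι ℝ} (hP : P.PosDef) (hK : K.IsHermitian)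
    {c : ℝ} : (∀ r ∈ spectrum ℝ (P⁻¹ * K), r ≤ c) ↔ ∀ v, v ⬝ᵥ K *ᵥ v ≤ c * (v ⬝ᵥ P *ᵥ v) := by
  constructor
  · intro h
    obtain ⟨B, hB, rfl⟩ : ∃ B : Matrix ι ι ℝ, IsUnit B ∧ P = Bᴴ * B := by
      open MatrixOrder in
      have := CStarAlgebra.isStrictlyPositive_iff_eq_star_mul_self.1 hP.isStrictlyPositive
      obtain ⟨B, hB, h⟩ := this
      exact ⟨B, hB, h⟩
    have hBdet : IsUnit B.det := (Matrix.isUnit_iff_isUnit_det _).1 hB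
    set H := (B⁻¹)ᴴ * K * B⁻¹ with hHdef
    have hH : H.IsHermitian := Matrix.isHermitian_conjTranspose_mul_mul _ hK
    have hHK : ∀ v, v ⬝ᵥ K *ᵥ v = (B *ᵥ v) ⬝ᵥ H *ᵥ (B *ᵥ v) := by
      intro v
      rw [hHdef, ← Matrix.mulVec_mulVec, ← Matrix.mulVec_mulVec, Matrix.mulVec_mulVec v,
        Matrix.nonsing_inv_mul _ hBdet, one_mulVec, conjTranspose_eq_transpose_of_trivial,
        Matrix.dotProduct_mulVec (B *ᵥ v), Matrix.vecMul_transpose, Matrix.mulVec_mulVec,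
        Matrix.nonsing_inv_mul _ hBdet, one_mulVec]
    have hs : ∀ r ∈ spectrum ℝ H, r ≤ c := by
      intro r hr
      refine h r ((mem_spectrum_inv_mul_iff hP).2 ?_)
      obtain ⟨u, hu0, hu⟩ := mem_spectrum_iff_exists_mulVec_eq_smul.1 hr
      refine ⟨B⁻¹ *ᵥ u, fun h0 => hu0 ?_, ?_⟩
      · have := congrArg (B *ᵥ ·) h0
        simpa [Matrix.mul_nonsing_inv _ hBdet] using this
      · have h2 := congrArg (Bᴴ *ᵥ ·) hu
        have h3 : Bᴴ * (B⁻¹)ᴴ = 1 := by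
          rw [← conjTranspose_mul, Matrix.nonsing_inv_mul _ hBdet, conjTranspose_one]
        simp only [hHdef, Matrix.mulVec_mulVec, ← Matrix.mul_assoc, h3, Matrix.mulVec_smul,
          one_mul] at h2
        rw [Matrix.mulVec_mulVec, h2, Matrix.mulVec_mulVec, Matrix.mul_assoc,
          Matrix.mul_nonsing_inv _ hBdet, mul_one]
    intro v
    rw [hHK]
    refine (quadForm_le_of_spectrum_le hH hs _).trans (le_of_eq ?_)
    rw [← Matrix.mulVec_mulVec, conjTranspose_eq_transpose_of_trivial,
      Matrix.dotProduct_mulVec v, Matrix.vecMul_transpose]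
  · intro h r hr
    obtain ⟨v, hv0, hv⟩ := (mem_spectrum_inv_mul_iff hP).1 hr
    have h1 := h v
    have h2 : 0 < v ⬝ᵥ P *ᵥ v := by simpa using hP.dotProduct_mulVec_pos hv0
    rw [hv, dotProduct_smul, smul_eq_mul] at h1
    exact le_of_mul_le_mul_right h1 h2

lemma forall_mem_spectrum_ge_iff {P K : Matrix ι ι ℝ} (hP : P.PosDef) (hK : K.IsHermitian)
    {c : ℝ} : (∀ r ∈ spectrum ℝ (P⁻¹ * K), c ≤ r) ↔ ∀ v, c * (v ⬝ᵥ P *ᵥ v) ≤ v ⬝ᵥ K *ᵥ v := by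
  have h := forall_mem_spectrum_le_iff hP hK.neg (c := -c)
  rw [Matrix.mul_neg, ← spectrum.neg_eq] at h
  simp only [Set.mem_neg, Matrix.neg_mulVec, dotProduct_neg, neg_mul, neg_le_neg_iff] at h
  rw [← h]
  exact ⟨fun h r hr => by linarith [h _ hr], fun h r hr => by
    have := h (-r) (by simpa using hr)
    linarith⟩

lemma spectrum_inv_mul_nonempty [Nonempty ι] {P K : Matrix ι ι ℝ} (hP : P.PosDef)
    (hK : K.IsHermitian) : (spectrum ℝ (P⁻¹ * K)).Nonempty := by
  by_contra h
  rw [Set.not_nonempty_iff_eq_empty] at h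
  have h1 := (forall_mem_spectrum_le_iff hP hK (c := -1)).1 (by simp [h]) 1
  have h2 := (forall_mem_spectrum_ge_iff hP hK (c := 1)).1 (by simp [h]) 1
  have h3 : 0 < (1 : ι → ℝ) ⬝ᵥ P *ᵥ 1 := by simpa using hP.dotProduct_mulVec_pos one_ne_zero
  linarith

lemma lambdaMax_le_iff [Nonempty ι] {P K : Matrix ι ι ℝ} (hP : P.PosDef) (hK : K.IsHermitian)
    {c : ℝ} : lambdaMax (P⁻¹ * K) ≤ c ↔ ∀ v, v ⬝ᵥ K *ᵥ v ≤ c * (v ⬝ᵥ P *ᵥ v) := by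
  rw [← forall_mem_spectrum_le_iff hP hK]
  exact csSup_le_iff (Matrix.finite_spectrum _).bddAbove (spectrum_inv_mul_nonempty hP hK)

lemma le_lambdaMin_iff [Nonempty ι] {P K : Matrix ι ι ℝ} (hP : P.PosDef) (hK : K.IsHermitian)
    {c : ℝ} : c ≤ lambdaMin (P⁻¹ * K) ↔ ∀ v, c * (v ⬝ᵥ P *ᵥ v) ≤ v ⬝ᵥ K *ᵥ v := by
  rw [← forall_mem_spectrum_ge_iff hP hK]
  exact le_csInf_iff (Matrix.finite_spectrum _).bddBelow (spectrum_inv_mul_nonempty hP hK)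

/-- The complex eigenvalues of a pencil of positive definite real matrices are positive reals. -/
lemma spectrum_map_ofReal_pos {P K : Matrix ι ι ℝ} (hP : P.PosDef) (hK : K.PosDef) {ζ : ℂ}
    (hζ : ζ ∈ spectrum ℂ ((P⁻¹ * K).map Complex.ofReal)) : ζ.im = 0 ∧ 0 < ζ.re := by
  have hdet : IsUnit P.det := (Matrix.isUnit_iff_isUnit_det _).1 hP.isUnit
  obtain ⟨v, hv0, hv⟩ := mem_spectrum_iff_exists_mulVec_eq_smul.1 hζ
  set a : ι → ℝ := fun i => (v i).re with ha
  set c : ι → ℝ := fun i => (v i).im with hc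
  have hre : (P⁻¹ * K) *ᵥ a = ζ.re • a - ζ.im • c := by
    ext i
    have := congrArg Complex.re (congrFun hv i)
    simpa [Matrix.mulVec, dotProduct, ha, hc] using this
  have him : (P⁻¹ * K) *ᵥ c = ζ.im • a + ζ.re • c := by
    ext i
    have := congrArg Complex.im (congrFun hv i)
    simp [Matrix.mulVec, dotProduct, ha, hc] at this ⊢
    linarith
  have key : ∀ u, P *ᵥ ((P⁻¹ * K) *ᵥ u) = K *ᵥ u := fun u => by
    rw [Matrix.mulVec_mulVec, ← Matrix.mul_assoc, Matrix.mul_nonsing_inv _ hdet, one_mul]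
  have hre' : K *ᵥ a = ζ.re • P *ᵥ a - ζ.im • P *ᵥ c := by
    rw [← key, hre, mulVec_sub, mulVec_smul, mulVec_smul]
  have him' : K *ᵥ c = ζ.im • P *ᵥ a + ζ.re • P *ᵥ c := by
    rw [← key, him, mulVec_add, mulVec_smul, mulVec_smul]
  have hsymm : ∀ {S : Matrix ι ι ℝ}, S.PosDef → c ⬝ᵥ S *ᵥ a = a ⬝ᵥ S *ᵥ c := fun {S} hS => by
    have h : Sᵀ = S := (conjTranspose_eq_transpose_of_trivial S).symm.trans hS.1
    rw [dotProduct_comm, ← Matrix.vecMul_transpose, h, ← Matrix.dotProduct_mulVec]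
  have hpos : ∀ {S : Matrix ι ι ℝ}, S.PosDef → 0 < a ⬝ᵥ S *ᵥ a + c ⬝ᵥ S *ᵥ c := fun {S} hS => by
    have hnn : ∀ u, 0 ≤ u ⬝ᵥ S *ᵥ u := fun u => by
      simpa using hS.posSemidef.dotProduct_mulVec_nonneg u
    have hne : ∀ u, u ≠ 0 → 0 < u ⬝ᵥ S *ᵥ u := fun u hu => by
      simpa using hS.dotProduct_mulVec_pos hu
    by_cases h : a = 0
    · have : c ≠ 0 := fun h' => hv0 (funext fun i =>
        Complex.ext (congrFun h i) (congrFun h' i))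
      linarith [hnn a, hne c this]
    · linarith [hnn c, hne a h]
  have h1 : c ⬝ᵥ K *ᵥ a = ζ.re * (c ⬝ᵥ P *ᵥ a) - ζ.im * (c ⬝ᵥ P *ᵥ c) := by
    rw [hre', dotProduct_sub, dotProduct_smul, dotProduct_smul]; rfl
  have h2 : a ⬝ᵥ K *ᵥ c = ζ.im * (a ⬝ᵥ P *ᵥ a) + ζ.re * (a ⬝ᵥ P *ᵥ c) := by
    rw [him', dotProduct_add, dotProduct_smul, dotProduct_smul]; rfl
  have h3 : a ⬝ᵥ K *ᵥ a = ζ.re * (a ⬝ᵥ P *ᵥ a) - ζ.im * (a ⬝ᵥ P *ᵥ c) := by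
    rw [hre', dotProduct_sub, dotProduct_smul, dotProduct_smul]; rfl
  have h4 : c ⬝ᵥ K *ᵥ c = ζ.im * (c ⬝ᵥ P *ᵥ a) + ζ.re * (c ⬝ᵥ P *ᵥ c) := by
    rw [him', dotProduct_add, dotProduct_smul, dotProduct_smul]; rfl
  have hP' := hpos hP
  have hK' := hpos hK
  rw [hsymm hK, hsymm hP] at h1
  rw [hsymm hP] at h4
  have him0 : ζ.im * (a ⬝ᵥ P *ᵥ a + c ⬝ᵥ P *ᵥ c) = 0 := by linarith
  refine ⟨(mul_eq_zero.1 him0).resolve_right hP'.ne', ?_⟩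
  refine pos_of_mul_pos_left (b := a ⬝ᵥ P *ᵥ a + c ⬝ᵥ P *ᵥ c) ?_ hP'.le
  linarith

end Spectrum

section QuadraticForms

variable {m n : ℕ}

/-- The diagonal of the Schur complement `Λ₁ - Λ₂ Λ₁⁻¹ Λ₂`. -/
def schurDiag (w : Iterate n) (i : Fin n) : ℝ := 4 / (w.s₁ i / w.ν₁ i + w.s₂ i / w.ν₂ i)

/-- Positivity of the slacks and of the bound multipliers. -/
def IsInterior (w : Iterate n) : Prop :=
  ∀ i, 0 < w.s₁ i ∧ 0 < w.s₂ i ∧ 0 < w.ν₁ i ∧ 0 < w.ν₂ i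

lemma schurDiag_pos {w : Iterate n} (hw : IsInterior w) (i : Fin n) : 0 < schurDiag w i := by
  obtain ⟨h1, h2, h3, h4⟩ := hw i
  unfold schurDiag
  positivity

/-- The quadratic form of the block matrix `[Λ₁, Λ₂; Λ₂, Λ₁]`. -/
def barrierForm (w : Iterate n) (x y : Fin n → ℝ) : ℝ :=
  ∑ i, ((w.s₁ i)⁻¹ * w.ν₁ i * (x i + y i) ^ 2 + (w.s₂ i)⁻¹ * w.ν₂ i * (x i - y i) ^ 2)

lemma quadForm_block (w : Iterate n) (S : Matrix (Fin n) (Fin n) ℝ) (x y : Fin n → ℝ) :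
    Sum.elim x y ⬝ᵥ fromBlocks (S + Lambda₁ w) (Lambda₂ w) (Lambda₂ w) (Lambda₁ w) *ᵥ Sum.elim x y
      = x ⬝ᵥ S *ᵥ x + barrierForm w x y := by
  rw [fromBlocks_mulVec, sumElim_dotProduct_sumElim]
  simp only [Sum.elim_comp_inl, Sum.elim_comp_inr, add_mulVec, dotProduct_add, add_assoc]
  congr 1
  simp only [Lambda₁, Lambda₂, sigma₁, sigma₂, add_mulVec, sub_mulVec, dotProduct, Pi.add_apply,
    Pi.sub_apply, mulVec_diagonal, barrierForm, ← Finset.sum_add_distrib]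
  exact Finset.sum_congr rfl fun i _ => by ring

lemma quadForm_condensedKKT (M : Matrix (Fin m) (Fin n) ℝ) (w : Iterate n) (x y : Fin n → ℝ) :
    Sum.elim x y ⬝ᵥ condensedKKT M w *ᵥ Sum.elim x y
      = (M *ᵥ x) ⬝ᵥ (M *ᵥ x) + barrierForm w x y := by
  rw [condensedKKT, quadForm_block, ← mulVec_mulVec, dotProduct_mulVec, vecMul_transpose]

lemma quadForm_preconditioner (w : Iterate n) (x y : Fin n → ℝ) :
    Sum.elim x y ⬝ᵥ preconditioner w *ᵥ Sum.elim x y = x ⬝ᵥ x + barrierForm w x y := by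
  rw [preconditioner, quadForm_block, one_mulVec]

lemma isHermitian_block (w : Iterate n) {S : Matrix (Fin n) (Fin n) ℝ} (hS : S.IsHermitian) :
    (fromBlocks (S + Lambda₁ w) (Lambda₂ w) (Lambda₂ w) (Lambda₁ w)).IsHermitian := by
  have h1 : (Lambda₁ w).IsHermitian := (isHermitian_diagonal _).add (isHermitian_diagonal _)
  have h2 : (Lambda₂ w).IsHermitian := (isHermitian_diagonal _).sub (isHermitian_diagonal _)
  exact (hS.add h1).fromBlocks h2 h1

lemma isHermitian_condensedKKT (M : Matrix (Fin m) (Fin n) ℝ) (w : Iterate n) :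
    (condensedKKT M w).IsHermitian :=
  isHermitian_block w (by simpa using isHermitian_conjTranspose_mul_self M)

lemma barrierForm_pos {w : Iterate n} (hw : IsInterior w) {v : Fin n ⊕ Fin n → ℝ} (hv : v ≠ 0) :
    0 < barrierForm w (v ∘ Sum.inl) (v ∘ Sum.inr) := by
  obtain ⟨i, hi⟩ : ∃ i, v (.inl i) ≠ 0 ∨ v (.inr i) ≠ 0 := by
    by_contra! h
    exact hv (funext fun j => j.casesOn (fun i => (h i).1) fun i => (h i).2)
  refine Finset.sum_pos' (fun j _ => ?_) ⟨i, Finset.mem_univ _, ?_⟩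
  · obtain ⟨h1, h2, h3, h4⟩ := hw j
    positivity
  · obtain ⟨h1, h2, h3, h4⟩ := hw i
    have h5 : 0 < (w.s₁ i)⁻¹ * w.ν₁ i := by positivity
    have h6 : 0 < (w.s₂ i)⁻¹ * w.ν₂ i := by positivity
    simp only [Function.comp]
    rcases eq_or_ne (v (.inl i) + v (.inr i)) 0 with h | h
    · have h' : v (.inl i) - v (.inr i) ≠ 0 := by
        rintro h'
        rcases hi with hi | hi <;> exact hi (by linarith)
      positivity
    · positivity

lemma posDef_condensedKKT (M : Matrix (Fin m) (Fin n) ℝ) {w : Iterate n} (hw : IsInterior w) :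
    (condensedKKT M w).PosDef := by
  refine .of_dotProduct_mulVec_pos (isHermitian_condensedKKT M w) fun v hv => ?_
  have h := quadForm_condensedKKT M w (v ∘ Sum.inl) (v ∘ Sum.inr)
  rw [Sum.elim_comp_inl_inr] at h
  rw [star_trivial, h]
  have h1 := barrierForm_pos hw hv
  have h2 : 0 ≤ (M *ᵥ (v ∘ Sum.inl)) ⬝ᵥ (M *ᵥ (v ∘ Sum.inl)) :=
    Finset.sum_nonneg fun i _ => mul_self_nonneg _
  linarith

lemma posDef_preconditioner {w : Iterate n} (hw : IsInterior w) : (preconditioner w).PosDef := by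
  refine .of_dotProduct_mulVec_pos (isHermitian_block w isHermitian_one) fun v hv => ?_
  have h := quadForm_preconditioner w (v ∘ Sum.inl) (v ∘ Sum.inr)
  rw [Sum.elim_comp_inl_inr] at h
  rw [star_trivial, h]
  have h1 := barrierForm_pos hw hv
  have h2 : 0 ≤ (v ∘ Sum.inl) ⬝ᵥ (v ∘ Sum.inl) := Finset.sum_nonneg fun i _ => mul_self_nonneg _
  linarith

lemma schurDiag_eq {w : Iterate n} (hw : IsInterior w) (i : Fin n) :
    schurDiag w i = 4 * ((w.s₁ i)⁻¹ * w.ν₁ i) * ((w.s₂ i)⁻¹ * w.ν₂ i) /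
      ((w.s₁ i)⁻¹ * w.ν₁ i + (w.s₂ i)⁻¹ * w.ν₂ i) := by
  obtain ⟨h1, h2, h3, h4⟩ := hw i
  unfold schurDiag
  field_simp
  ring

lemma sum_schurDiag_le_barrierForm {w : Iterate n} (hw : IsInterior w) (x y : Fin n → ℝ) :
    ∑ i, schurDiag w i * x i ^ 2 ≤ barrierForm w x y := by
  refine Finset.sum_le_sum fun i _ => ?_
  rw [schurDiag_eq hw]
  obtain ⟨h1, h2, h3, h4⟩ := hw i
  have h5 : 0 < (w.s₁ i)⁻¹ * w.ν₁ i := by positivity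
  have h6 : 0 < (w.s₂ i)⁻¹ * w.ν₂ i := by positivity
  set a := (w.s₁ i)⁻¹ * w.ν₁ i
  set c := (w.s₂ i)⁻¹ * w.ν₂ i
  rw [div_mul_eq_mul_div, div_le_iff₀ (by positivity)]
  nlinarith [sq_nonneg ((a - c) * x i + (a + c) * y i)]

lemma exists_barrierForm_eq {w : Iterate n} (hw : IsInterior w) (x : Fin n → ℝ) :
    ∃ y, barrierForm w x y = ∑ i, schurDiag w i * x i ^ 2 := by
  refine ⟨fun i => -((w.s₁ i)⁻¹ * w.ν₁ i - (w.s₂ i)⁻¹ * w.ν₂ i) /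
    ((w.s₁ i)⁻¹ * w.ν₁ i + (w.s₂ i)⁻¹ * w.ν₂ i) * x i, Finset.sum_congr rfl fun i _ => ?_⟩
  rw [schurDiag_eq hw]
  obtain ⟨h1, h2, h3, h4⟩ := hw i
  have h5 : 0 < (w.s₁ i)⁻¹ * w.ν₁ i := by positivity
  have h6 : 0 < (w.s₂ i)⁻¹ * w.ν₂ i := by positivity
  have key : ∀ a c t : ℝ, 0 < a → 0 < c → a * (t + -(a - c) / (a + c) * t) ^ 2 +
      c * (t - -(a - c) / (a + c) * t) ^ 2 = 4 * a * c / (a + c) * t ^ 2 := by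
    intro a c t ha hc
    field_simp
    ring
  exact key _ _ _ h5 h6

lemma barrierForm_zero_one_pos [NeZero n] {w : Iterate n} (hw : IsInterior w) :
    0 < barrierForm w 0 1 :=
  barrierForm_pos hw (v := Sum.elim 0 1) fun h => one_ne_zero (congrFun h (.inr 0))

lemma lambdaMax_preconditionedKKT_le_iff [NeZero n] (M : Matrix (Fin m) (Fin n) ℝ) {w : Iterate n}
    (hw : IsInterior w) {c : ℝ} :
    lambdaMax (preconditionedKKT M w) ≤ c ↔ 1 ≤ c ∧ ∀ x : Fin n → ℝ,
      (M *ᵥ x) ⬝ᵥ (M *ᵥ x) + ∑ i, schurDiag w i * x i ^ 2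
        ≤ c * (x ⬝ᵥ x + ∑ i, schurDiag w i * x i ^ 2) := by
  rw [preconditionedKKT,
    lambdaMax_le_iff (posDef_preconditioner hw) (isHermitian_condensedKKT M w)]
  constructor
  · intro h
    refine ⟨?_, fun x => ?_⟩
    · have h1 := h (Sum.elim 0 1)
      rw [quadForm_condensedKKT, quadForm_preconditioner] at h1
      have h2 := barrierForm_zero_one_pos hw
      simp only [mulVec_zero, dotProduct_zero, zero_add] at h1
      exact (le_mul_iff_one_le_left h2).1 h1
    · obtain ⟨y, hy⟩ := exists_barrierForm_eq hw x
      have h1 := h (Sum.elim x y)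
      rwa [quadForm_condensedKKT, quadForm_preconditioner, hy] at h1
  · rintro ⟨hc, h⟩ v
    rw [← Sum.elim_comp_inl_inr v, quadForm_condensedKKT, quadForm_preconditioner]
    have h1 := h (v ∘ Sum.inl)
    have h2 := sum_schurDiag_le_barrierForm hw (v ∘ Sum.inl) (v ∘ Sum.inr)
    nlinarith [mul_nonneg (sub_nonneg.2 hc) (sub_nonneg.2 h2)]

lemma le_lambdaMin_preconditionedKKT_iff [NeZero n] (M : Matrix (Fin m) (Fin n) ℝ) {w : Iterate n}
    (hw : IsInterior w) {c : ℝ} :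
    c ≤ lambdaMin (preconditionedKKT M w) ↔ c ≤ 1 ∧ ∀ x : Fin n → ℝ,
      c * (x ⬝ᵥ x + ∑ i, schurDiag w i * x i ^ 2)
        ≤ (M *ᵥ x) ⬝ᵥ (M *ᵥ x) + ∑ i, schurDiag w i * x i ^ 2 := by
  rw [preconditionedKKT,
    le_lambdaMin_iff (posDef_preconditioner hw) (isHermitian_condensedKKT M w)]
  constructor
  · intro h
    refine ⟨?_, fun x => ?_⟩
    · have h1 := h (Sum.elim 0 1)
      rw [quadForm_condensedKKT, quadForm_preconditioner] at h1
      have h2 := barrierForm_zero_one_pos hw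
      simp only [mulVec_zero, dotProduct_zero, zero_add] at h1
      exact (mul_le_iff_le_one_left h2).1 h1
    · obtain ⟨y, hy⟩ := exists_barrierForm_eq hw x
      have h1 := h (Sum.elim x y)
      rwa [quadForm_condensedKKT, quadForm_preconditioner, hy] at h1
  · rintro ⟨hc, h⟩ v
    rw [← Sum.elim_comp_inl_inr v, quadForm_condensedKKT, quadForm_preconditioner]
    have h1 := h (v ∘ Sum.inl)
    have h2 := sum_schurDiag_le_barrierForm hw (v ∘ Sum.inl) (v ∘ Sum.inr)
    nlinarith [mul_nonneg (sub_nonneg.2 hc) (sub_nonneg.2 h2)]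

lemma mulVec_eq_activeSubmatrix_mulVec (M : Matrix (Fin m) (Fin n) ℝ) {β x : Fin n → ℝ}
    (hx : ∀ i, i ∉ activeSet β → x i = 0) :
    M *ᵥ x = activeSubmatrix M β *ᵥ fun i => x i := by
  ext k
  simp only [mulVec, dotProduct, activeSubmatrix, submatrix_apply, id]
  rw [Finset.sum_coe_sort (activeSet β) fun i => M k i * x i]
  exact (Finset.sum_subset (Finset.subset_univ _) fun i _ hi => by rw [hx i hi, mul_zero]).symm

lemma dotProduct_self_eq_of_support {β x : Fin n → ℝ} (hx : ∀ i, i ∉ activeSet β → x i = 0) :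
    x ⬝ᵥ x = (fun i : activeSet β => x i) ⬝ᵥ fun i : activeSet β => x i := by
  simp only [dotProduct]
  rw [Finset.sum_coe_sort (activeSet β) fun i => x i * x i]
  exact (Finset.sum_subset (Finset.subset_univ _) fun i _ hi => by rw [hx i hi, mul_zero]).symm

lemma activeGram_eq (M : Matrix (Fin m) (Fin n) ℝ) (β : Fin n → ℝ) :
    activeGram M β = (activeSubmatrix M β)ᵀ * activeSubmatrix M β := rfl

lemma quadForm_activeGram (M : Matrix (Fin m) (Fin n) ℝ) {β x : Fin n → ℝ}
    (hx : ∀ i, i ∉ activeSet β → x i = 0) :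
    (fun i : activeSet β => x i) ⬝ᵥ activeGram M β *ᵥ (fun i : activeSet β => x i)
      = (M *ᵥ x) ⬝ᵥ (M *ᵥ x) := by
  rw [mulVec_eq_activeSubmatrix_mulVec M hx, activeGram_eq, ← mulVec_mulVec, dotProduct_mulVec,
    vecMul_transpose]

lemma isHermitian_activeGram (M : Matrix (Fin m) (Fin n) ℝ) (β : Fin n → ℝ) :
    (activeGram M β).IsHermitian := by
  simpa [activeGram_eq] using isHermitian_conjTranspose_mul_self (activeSubmatrix M β)

lemma exists_extension (β : Fin n → ℝ) (u : activeSet β → ℝ) :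
    ∃ x : Fin n → ℝ, (∀ i, i ∉ activeSet β → x i = 0) ∧ (fun i : activeSet β => x i) = u :=
  ⟨fun i => if h : i ∈ activeSet β then u ⟨i, h⟩ else 0, fun _ hi => dif_neg hi,
    funext fun i => dif_pos i.2⟩

/-- The Rayleigh quotients of the active Gram matrix, on vectors supported in the active set. -/
lemma lambdaMax_activeGram_le_iff (M : Matrix (Fin m) (Fin n) ℝ) {β : Fin n → ℝ}
    (hA : (activeSet β).Nonempty) {c : ℝ} :
    lambdaMax (activeGram M β) ≤ c ↔ ∀ x : Fin n → ℝ, (∀ i, i ∉ activeSet β → x i = 0) →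
      (M *ᵥ x) ⬝ᵥ (M *ᵥ x) ≤ c * (x ⬝ᵥ x) := by
  have := hA.to_subtype
  have h := lambdaMax_le_iff (c := c) PosDef.one (isHermitian_activeGram M β)
  rw [inv_one, one_mul] at h
  rw [h]
  constructor
  · intro h x hx
    rw [← quadForm_activeGram M hx, dotProduct_self_eq_of_support hx]
    simpa using h fun i => x i
  · intro h u
    obtain ⟨x, hx, rfl⟩ := exists_extension β u
    rw [quadForm_activeGram M hx, one_mulVec, ← dotProduct_self_eq_of_support hx]
    exact h x hx

lemma le_lambdaMin_activeGram_iff (M : Matrix (Fin m) (Fin n) ℝ) {β : Fin n → ℝ}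
    (hA : (activeSet β).Nonempty) {c : ℝ} :
    c ≤ lambdaMin (activeGram M β) ↔ ∀ x : Fin n → ℝ, (∀ i, i ∉ activeSet β → x i = 0) →
      c * (x ⬝ᵥ x) ≤ (M *ᵥ x) ⬝ᵥ (M *ᵥ x) := by
  have := hA.to_subtype
  have h := le_lambdaMin_iff (c := c) PosDef.one (isHermitian_activeGram M β)
  rw [inv_one, one_mul] at h
  rw [h]
  constructor
  · intro h x hx
    rw [← quadForm_activeGram M hx, dotProduct_self_eq_of_support hx]
    simpa using h fun i => x i
  · intro h u
    obtain ⟨x, hx, rfl⟩ := exists_extension β u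
    rw [quadForm_activeGram M hx, one_mulVec, ← dotProduct_self_eq_of_support hx]
    exact h x hx

lemma lambdaMin_activeGram_pos (M : Matrix (Fin m) (Fin n) ℝ) {β : Fin n → ℝ}
    (hA : (activeSet β).Nonempty) (hrank : (activeSubmatrix M β).rank = (activeSet β).card) :
    0 < lambdaMin (activeGram M β) := by
  have := hA.to_subtype
  have hpd : (activeGram M β).PosDef := by
    rw [activeGram_eq, ← conjTranspose_eq_transpose_of_trivial]
    refine PosDef.conjTranspose_mul_self _ (mulVec_injective_iff.2 ?_)
    rw [linearIndependent_iff_card_eq_finrank_span, Set.finrank, ← rank_eq_finrank_span_cols, hrank,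
      Fintype.card_coe]
  have hne : (spectrum ℝ (activeGram M β)).Nonempty := by
    simpa using spectrum_inv_mul_nonempty PosDef.one (isHermitian_activeGram M β)
  have hmem := hne.csInf_mem (Matrix.finite_spectrum (activeGram M β))
  obtain ⟨v, hv0, hv⟩ := mem_spectrum_iff_exists_mulVec_eq_smul.1 hmem
  have h1 : 0 < v ⬝ᵥ activeGram M β *ᵥ v := by simpa using hpd.dotProduct_mulVec_pos hv0
  rw [hv, dotProduct_smul, smul_eq_mul] at h1
  exact pos_of_mul_pos_left h1 (Finset.sum_nonneg fun i _ => mul_self_nonneg _)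

end QuadraticForms

section EigenvalueLimits

variable {m n : ℕ}

lemma exists_mulVec_dotProduct_self_le (M : Matrix (Fin m) (Fin n) ℝ) :
    ∃ B, 0 ≤ B ∧ ∀ x : Fin n → ℝ, (M *ᵥ x) ⬝ᵥ (M *ᵥ x) ≤ B * (x ⬝ᵥ x) := by
  refine ⟨∑ k, ∑ i, M k i ^ 2, by positivity, fun x => ?_⟩
  simp only [dotProduct, mulVec, ← sq]
  rw [Finset.sum_mul]
  exact Finset.sum_le_sum fun k _ => Finset.sum_mul_sq_le_sq_mul_sq _ _ _

lemma dotProduct_add_self_le {ι : Type*} [Fintype ι] (a c : ι → ℝ) {δ : ℝ} (hδ : 0 < δ) :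
    (a + c) ⬝ᵥ (a + c) ≤ (1 + δ) * (a ⬝ᵥ a) + (1 + δ⁻¹) * (c ⬝ᵥ c) := by
  simp only [dotProduct, Finset.mul_sum, ← Finset.sum_add_distrib, Pi.add_apply]
  refine Finset.sum_le_sum fun i _ => ?_
  have h : 0 ≤ δ⁻¹ * (δ * a i - c i) ^ 2 := by positivity
  have h2 : δ⁻¹ * (δ * a i - c i) ^ 2 = δ * a i ^ 2 - 2 * a i * c i + δ⁻¹ * c i ^ 2 := by
    field_simp
    ring
  nlinarith

lemma le_dotProduct_add_self {ι : Type*} [Fintype ι] (a c : ι → ℝ) {δ : ℝ} (hδ : 0 < δ) :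
    (1 - δ) * (a ⬝ᵥ a) - δ⁻¹ * (c ⬝ᵥ c) ≤ (a + c) ⬝ᵥ (a + c) := by
  simp only [dotProduct, Finset.mul_sum, ← Finset.sum_sub_distrib, Pi.add_apply]
  refine Finset.sum_le_sum fun i _ => ?_
  have h : 0 ≤ δ⁻¹ * (δ * a i + c i) ^ 2 := by positivity
  have h2 : δ⁻¹ * (δ * a i + c i) ^ 2 = δ * a i ^ 2 + 2 * a i * c i + δ⁻¹ * c i ^ 2 := by
    field_simp
    ring
  nlinarith [sq_nonneg (c i)]

lemma exists_support_decomposition (A : Finset (Fin n)) (x : Fin n → ℝ) :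
    ∃ u v : Fin n → ℝ, u + v = x ∧ (∀ i, i ∉ A → u i = 0) ∧ x ⬝ᵥ x = u ⬝ᵥ u + v ⬝ᵥ v ∧
      ∀ T : ℝ, ∀ d : Fin n → ℝ, (∀ i, 0 ≤ d i) → (∀ i, i ∉ A → T ≤ d i) →
        T * (v ⬝ᵥ v) ≤ ∑ i, d i * x i ^ 2 := by
  refine ⟨fun i => if i ∈ A then x i else 0, fun i => if i ∈ A then 0 else x i, ?_,
    fun i hi => if_neg hi, ?_, fun T d hd hT => ?_⟩
  · ext i
    by_cases hi : i ∈ A <;> simp [hi]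
  · simp only [dotProduct, ← Finset.sum_add_distrib]
    refine Finset.sum_congr rfl fun i _ => ?_
    by_cases hi : i ∈ A <;> simp [hi]
  · simp only [dotProduct, Finset.mul_sum]
    refine Finset.sum_le_sum fun i _ => ?_
    by_cases hi : i ∈ A
    · simpa [hi] using mul_nonneg (hd i) (sq_nonneg (x i))
    · simpa [hi, ← sq] using mul_le_mul_of_nonneg_right (hT i hi) (sq_nonneg (x i))

lemma exists_rayleigh_upper_bound (M : Matrix (Fin m) (Fin n) ℝ) (A : Finset (Fin n)) {L ε : ℝ}
    (hL : 1 ≤ L) (hε : 0 < ε)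
    (hA : ∀ x : Fin n → ℝ, (∀ i, i ∉ A → x i = 0) → (M *ᵥ x) ⬝ᵥ (M *ᵥ x) ≤ L * (x ⬝ᵥ x)) :
    ∃ T, ∀ d : Fin n → ℝ, (∀ i, 0 ≤ d i) → (∀ i, i ∉ A → T ≤ d i) → ∀ x : Fin n → ℝ,
      (M *ᵥ x) ⬝ᵥ (M *ᵥ x) + ∑ i, d i * x i ^ 2 ≤ (L + ε) * (x ⬝ᵥ x + ∑ i, d i * x i ^ 2) := by
  obtain ⟨B, hB0, hB⟩ := exists_mulVec_dotProduct_self_le M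
  have hL0 : 0 < L := by linarith
  set δ := ε / L with hδ
  have hδ0 : 0 < δ := by positivity
  have hδL : δ * L = ε := by rw [hδ]; field_simp
  refine ⟨(1 + δ⁻¹) * B / ε, fun d hd hT x => ?_⟩
  obtain ⟨u, v, huv, hu, hx, hv⟩ := exists_support_decomposition A x
  have h1 := hv _ d hd hT
  have h2 := dotProduct_add_self_le (M *ᵥ u) (M *ᵥ v) hδ0
  rw [← mulVec_add, huv] at h2
  have h3 : (1 + δ) * ((M *ᵥ u) ⬝ᵥ (M *ᵥ u)) ≤ (L + ε) * (u ⬝ᵥ u) :=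
    calc _ ≤ (1 + δ) * (L * (u ⬝ᵥ u)) := by gcongr; exact hA u hu
      _ = (L + δ * L) * (u ⬝ᵥ u) := by ring
      _ = _ := by rw [hδL]
  have h4 : (1 + δ⁻¹) * ((M *ᵥ v) ⬝ᵥ (M *ᵥ v)) ≤ ε * ∑ i, d i * x i ^ 2 :=
    calc _ ≤ (1 + δ⁻¹) * (B * (v ⬝ᵥ v)) := by gcongr; exact hB v
      _ = ε * ((1 + δ⁻¹) * B / ε * (v ⬝ᵥ v)) := by field_simp
      _ ≤ _ := by gcongr
  have h5 : 0 ≤ ∑ i, d i * x i ^ 2 := Finset.sum_nonneg fun i _ => mul_nonneg (hd i) (sq_nonneg _)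
  have h6 : 0 ≤ v ⬝ᵥ v := Finset.sum_nonneg fun i _ => mul_self_nonneg _
  rw [hx]
  nlinarith

lemma exists_rayleigh_lower_bound (M : Matrix (Fin m) (Fin n) ℝ) (A : Finset (Fin n)) {l ε : ℝ}
    (hl : l ≤ 1) (hε : 0 < ε) (hε1 : ε ≤ 1)
    (hA : ∀ x : Fin n → ℝ, (∀ i, i ∉ A → x i = 0) → l * (x ⬝ᵥ x) ≤ (M *ᵥ x) ⬝ᵥ (M *ᵥ x)) :
    ∃ T, ∀ d : Fin n → ℝ, (∀ i, 0 ≤ d i) → (∀ i, i ∉ A → T ≤ d i) → ∀ x : Fin n → ℝ,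
      (l - ε) * (x ⬝ᵥ x + ∑ i, d i * x i ^ 2) ≤ (M *ᵥ x) ⬝ᵥ (M *ᵥ x) + ∑ i, d i * x i ^ 2 := by
  obtain ⟨B, hB0, hB⟩ := exists_mulVec_dotProduct_self_le M
  refine ⟨(ε⁻¹ * B + 1) / ε, fun d hd hT x => ?_⟩
  obtain ⟨u, v, huv, hu, hx, hv⟩ := exists_support_decomposition A x
  have h1 := hv _ d hd hT
  have h2 := le_dotProduct_add_self (M *ᵥ u) (M *ᵥ v) hε
  rw [← mulVec_add, huv] at h2
  have hu0 : 0 ≤ u ⬝ᵥ u := Finset.sum_nonneg fun i _ => mul_self_nonneg _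
  have hv0 : 0 ≤ v ⬝ᵥ v := Finset.sum_nonneg fun i _ => mul_self_nonneg _
  have h3 : (l - ε) * (u ⬝ᵥ u) ≤ (1 - ε) * ((M *ᵥ u) ⬝ᵥ (M *ᵥ u)) :=
    calc _ ≤ (1 - ε) * (l * (u ⬝ᵥ u)) := by
          nlinarith [mul_nonneg (mul_nonneg hε.le (sub_nonneg.2 hl)) hu0]
      _ ≤ _ := mul_le_mul_of_nonneg_left (hA u hu) (by linarith)
  have h4 : ε⁻¹ * ((M *ᵥ v) ⬝ᵥ (M *ᵥ v)) + v ⬝ᵥ v ≤ ε * ∑ i, d i * x i ^ 2 :=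
    calc _ ≤ ε⁻¹ * (B * (v ⬝ᵥ v)) + v ⬝ᵥ v := by gcongr; exact hB v
      _ = ε * ((ε⁻¹ * B + 1) / ε * (v ⬝ᵥ v)) := by field_simp
      _ ≤ _ := by gcongr
  have h5 : 0 ≤ ∑ i, d i * x i ^ 2 := Finset.sum_nonneg fun i _ => mul_nonneg (hd i) (sq_nonneg _)
  have h6 : (l - ε) * (v ⬝ᵥ v) ≤ 1 * (v ⬝ᵥ v) := by gcongr; linarith
  have h7 : l * ∑ i, d i * x i ^ 2 ≤ 1 * ∑ i, d i * x i ^ 2 := by gcongr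
  rw [hx]
  nlinarith

lemma sum_mul_sq_le_of_support {A : Finset (Fin n)} {d x : Fin n → ℝ} {η : ℝ}
    (hd : ∀ i ∈ A, d i ≤ η) (hx : ∀ i, i ∉ A → x i = 0) :
    ∑ i, d i * x i ^ 2 ≤ η * (x ⬝ᵥ x) := by
  simp only [dotProduct, Finset.mul_sum, ← sq]
  refine Finset.sum_le_sum fun i _ => ?_
  by_cases hi : i ∈ A
  · exact mul_le_mul_of_nonneg_right (hd i hi) (sq_nonneg _)
  · simp [hx i hi]

variable {F : Filter (Iterate n)} {A : Finset (Fin n)}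

lemma tendsto_lambdaMax_preconditionedKKT [NeZero n] (M : Matrix (Fin m) (Fin n) ℝ)
    (hF : ∀ᶠ w in F, IsInterior w) (hA : ∀ i ∈ A, Tendsto (fun w => schurDiag w i) F (𝓝 0))
    (hI : ∀ i, i ∉ A → Tendsto (fun w => schurDiag w i) F atTop) {L : ℝ}
    (hL : ∀ c, L ≤ c ↔ 1 ≤ c ∧ ∀ x : Fin n → ℝ, (∀ i, i ∉ A → x i = 0) →
      (M *ᵥ x) ⬝ᵥ (M *ᵥ x) ≤ c * (x ⬝ᵥ x)) :
    Tendsto (fun w => lambdaMax (preconditionedKKT M w)) F (𝓝 L) := by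
  rw [tendsto_order]
  refine ⟨fun c hc => ?_, fun c hc => ?_⟩
  · set η := (L - c) / 2 / (|c| + 1) with hη
    have hη0 : 0 < η := by have := sub_pos.2 hc; positivity
    filter_upwards [hF, (A.eventually_all).2 fun i hi => (hA i hi).eventually_le_const hη0]
      with w hw hd
    by_contra! hle
    obtain ⟨h1, h2⟩ := (lambdaMax_preconditionedKKT_le_iff M hw).1 hle
    have h3 : (c - 1) * η ≤ (L - c) / 2 :=
      calc _ ≤ (|c| + 1) * η := by gcongr; linarith [le_abs_self c]
        _ = _ := by rw [hη]; field_simp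
    have h4 : L ≤ (c + L) / 2 := by
      refine (hL _).2 ⟨by linarith, fun x hx => ?_⟩
      have h5 := h2 x
      have h6 := sum_mul_sq_le_of_support hd hx
      have h7 : 0 ≤ x ⬝ᵥ x := Finset.sum_nonneg fun i _ => mul_self_nonneg _
      have h8 := mul_le_mul_of_nonneg_left h6 (sub_nonneg.2 h1)
      have h9 := mul_le_mul_of_nonneg_right h3 h7
      nlinarith
    linarith
  · obtain ⟨h1, h2⟩ := (hL L).1 le_rfl
    obtain ⟨T, hT⟩ := exists_rayleigh_upper_bound M A h1 (half_pos (sub_pos.2 hc)) h2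
    have hIT : ∀ᶠ w in F, ∀ i, i ∉ A → T ≤ schurDiag w i :=
      eventually_all.2 fun i => eventually_imp_distrib_left.2 fun hi =>
        (hI i hi).eventually_ge_atTop T
    filter_upwards [hF, hIT] with w hw hd
    have h3 : lambdaMax (preconditionedKKT M w) ≤ L + (c - L) / 2 :=
      (lambdaMax_preconditionedKKT_le_iff M hw).2
        ⟨by linarith, hT _ (fun i => (schurDiag_pos hw i).le) hd⟩
    linarith

lemma tendsto_lambdaMin_preconditionedKKT [NeZero n] (M : Matrix (Fin m) (Fin n) ℝ)
    (hF : ∀ᶠ w in F, IsInterior w) (hA : ∀ i ∈ A, Tendsto (fun w => schurDiag w i) F (𝓝 0))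
    (hI : ∀ i, i ∉ A → Tendsto (fun w => schurDiag w i) F atTop) {l : ℝ}
    (hl : ∀ c, c ≤ l ↔ c ≤ 1 ∧ ∀ x : Fin n → ℝ, (∀ i, i ∉ A → x i = 0) →
      c * (x ⬝ᵥ x) ≤ (M *ᵥ x) ⬝ᵥ (M *ᵥ x)) :
    Tendsto (fun w => lambdaMin (preconditionedKKT M w)) F (𝓝 l) := by
  rw [tendsto_order]
  refine ⟨fun c hc => ?_, fun c hc => ?_⟩
  · obtain ⟨h1, h2⟩ := (hl l).1 le_rfl
    have hε : 0 < min 1 ((l - c) / 2) := lt_min one_pos (half_pos (sub_pos.2 hc))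
    obtain ⟨T, hT⟩ := exists_rayleigh_lower_bound M A h1 hε (min_le_left _ _) h2
    have hIT : ∀ᶠ w in F, ∀ i, i ∉ A → T ≤ schurDiag w i :=
      eventually_all.2 fun i => eventually_imp_distrib_left.2 fun hi =>
        (hI i hi).eventually_ge_atTop T
    filter_upwards [hF, hIT] with w hw hd
    have h3 : l - min 1 ((l - c) / 2) ≤ lambdaMin (preconditionedKKT M w) :=
      (le_lambdaMin_preconditionedKKT_iff M hw).2
        ⟨by linarith, hT _ (fun i => (schurDiag_pos hw i).le) hd⟩
    linarith [min_le_right 1 ((l - c) / 2)]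
  · set η := (c - l) / 2 / (|c| + 1) with hη
    have hη0 : 0 < η := by have := sub_pos.2 hc; positivity
    filter_upwards [hF, (A.eventually_all).2 fun i hi => (hA i hi).eventually_le_const hη0]
      with w hw hd
    by_contra! hle
    obtain ⟨h1, h2⟩ := (le_lambdaMin_preconditionedKKT_iff M hw).1 hle
    have h3 : (1 - c) * η ≤ (c - l) / 2 :=
      calc _ ≤ (|c| + 1) * η := by gcongr; linarith [neg_abs_le c]
        _ = _ := by rw [hη]; field_simp
    have h4 : (c + l) / 2 ≤ l := by
      refine (hl _).2 ⟨by linarith, fun x hx => ?_⟩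
      have h5 := h2 x
      have h6 := sum_mul_sq_le_of_support hd hx
      have h7 : 0 ≤ x ⬝ᵥ x := Finset.sum_nonneg fun i _ => mul_self_nonneg _
      have h8 := mul_le_mul_of_nonneg_left h6 (sub_nonneg.2 h1)
      have h9 := mul_le_mul_of_nonneg_right h3 h7
      nlinarith
    linarith

lemma spectralCond_le_of_le_schurDiag [NeZero n] (M : Matrix (Fin m) (Fin n) ℝ) {t : ℝ}
    (ht : 0 < t) :
    ∃ B, ∀ w, IsInterior w → (∀ i, t ≤ schurDiag w i) →
      spectralCond (preconditionedKKT M w) ≤ B := by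
  obtain ⟨B, hB0, hB⟩ := exists_mulVec_dotProduct_self_le M
  refine ⟨(B + 1) / (t / (1 + t)), fun w hw hd => ?_⟩
  have hS0 : ∀ x : Fin n → ℝ, 0 ≤ ∑ i, schurDiag w i * x i ^ 2 := fun x =>
    Finset.sum_nonneg fun i _ => mul_nonneg (schurDiag_pos hw i).le (sq_nonneg _)
  have hx0 : ∀ x : Fin n → ℝ, 0 ≤ x ⬝ᵥ x := fun x =>
    Finset.sum_nonneg fun i _ => mul_self_nonneg _
  have hmax : lambdaMax (preconditionedKKT M w) ≤ B + 1 :=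
    (lambdaMax_preconditionedKKT_le_iff M hw).2 ⟨by linarith, fun x => by
      nlinarith [hB x, hS0 x, hx0 x, mul_nonneg hB0 (hS0 x)]⟩
  have hmin : t / (1 + t) ≤ lambdaMin (preconditionedKKT M w) := by
    refine (le_lambdaMin_preconditionedKKT_iff M hw).2 ⟨?_, fun x => ?_⟩
    · rw [div_le_one (by positivity)]
      linarith
    · have h1 : t * (x ⬝ᵥ x) ≤ ∑ i, schurDiag w i * x i ^ 2 := by
        simp only [dotProduct, Finset.mul_sum, ← sq]
        exact Finset.sum_le_sum fun i _ => mul_le_mul_of_nonneg_right (hd i) (sq_nonneg _)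
      have h2 : 0 ≤ (M *ᵥ x) ⬝ᵥ (M *ᵥ x) := Finset.sum_nonneg fun i _ => mul_self_nonneg _
      rw [div_mul_eq_mul_div, div_le_iff₀ (by positivity)]
      nlinarith [mul_nonneg ht.le h2, mul_nonneg ht.le (hS0 x)]
  exact div_le_div₀ (by linarith) hmax (by positivity) hmin

end EigenvalueLimits

section Convergence

variable {m n : ℕ}

lemma abs_apply_le_euclNorm {ι : Type*} [Fintype ι] (x : ι → ℝ) (i : ι) : |x i| ≤ euclNorm x :=
  Real.abs_le_sqrt
    (Finset.single_le_sum (f := fun i => x i ^ 2) (fun j _ => sq_nonneg (x j)) (Finset.mem_univ i))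

lemma residual_bounds {M : Matrix (Fin m) (Fin n) ℝ} {b : Fin m → ℝ} {lam C γ : ℝ} {w : Iterate n}
    (hw : w ∈ centralNbhd M b lam C γ) (i : Fin n) :
    |(Mᵀ *ᵥ (M *ᵥ w.β - b)) i - w.y₁ i + w.y₂ i| ≤ C * dualityMeasure w ∧
    |lam - w.y₁ i - w.y₂ i| ≤ C * dualityMeasure w ∧
    |w.y₁ i - w.ν₁ i| ≤ C * dualityMeasure w ∧ |w.y₂ i - w.ν₂ i| ≤ C * dualityMeasure w ∧
    |w.z i + w.β i - w.s₁ i| ≤ C * dualityMeasure w ∧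
    |w.z i - w.β i - w.s₂ i| ≤ C * dualityMeasure w := by
  obtain ⟨h1, h2, h3, -⟩ := hw
  have h := fun j => (abs_apply_le_euclNorm (gradLagrangian M b lam w) j).trans h1
  exact ⟨h (.inl i), h (.inr (.inl i)), h (.inr (.inr (.inl i))), h (.inr (.inr (.inr i))),
    (abs_apply_le_euclNorm _ i).trans h2, (abs_apply_le_euclNorm _ i).trans h3⟩

lemma IsKKT.mul_eq_zero {M : Matrix (Fin m) (Fin n) ℝ} {b : Fin m → ℝ} {lam : ℝ}
    {w : Iterate n} (h : IsKKT M b lam w) (i : Fin n) :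
    w.s₁ i * w.ν₁ i = 0 ∧ w.s₂ i * w.ν₂ i = 0 :=
  ⟨(Finset.sum_eq_zero_iff_of_nonneg fun j _ => mul_nonneg (h.s₁_nonneg j) (h.ν₁_nonneg j)).1
      h.compl₁ i (Finset.mem_univ i),
    (Finset.sum_eq_zero_iff_of_nonneg fun j _ => mul_nonneg (h.s₂_nonneg j) (h.ν₂_nonneg j)).1
      h.compl₂ i (Finset.mem_univ i)⟩

lemma IsKKT.apply {M : Matrix (Fin m) (Fin n) ℝ} {b : Fin m → ℝ} {lam : ℝ}
    {w : Iterate n} (h : IsKKT M b lam w) (i : Fin n) :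
    (Mᵀ *ᵥ (M *ᵥ w.β - b)) i - w.y₁ i + w.y₂ i = 0 ∧ w.ν₁ i + w.ν₂ i = lam ∧
    w.y₁ i = w.ν₁ i ∧ w.y₂ i = w.ν₂ i ∧ w.s₁ i = w.z i + w.β i ∧ w.s₂ i = w.z i - w.β i := by
  have h1 := congrFun h.stationary_β i
  have h2 := h.stationary_z i
  have h3 := congrFun h.stationary_s₁ i
  have h4 := congrFun h.stationary_s₂ i
  have h5 := congrFun h.feasible₁ i
  have h6 := congrFun h.feasible₂ i
  simp only [Pi.add_apply, Pi.sub_apply, Pi.zero_apply] at h1 h3 h4 h5 h6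
  exact ⟨h1, by linarith, by linarith, by linarith, by linarith, by linarith⟩

lemma IsKKT.active {M : Matrix (Fin m) (Fin n) ℝ} {b : Fin m → ℝ} {lam : ℝ} (hlam : 0 < lam)
    {w : Iterate n} (h : IsKKT M b lam w) {i : Fin n} (hi : i ∈ activeSet w.β) :
    (0 < w.s₁ i ∧ w.s₂ i = 0 ∧ 0 < w.ν₂ i) ∨ (0 < w.s₂ i ∧ w.s₁ i = 0 ∧ 0 < w.ν₁ i) := by
  have hβ : w.β i ≠ 0 := by simpa [activeSet] using hi
  obtain ⟨h1, h2⟩ := h.mul_eq_zero i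
  obtain ⟨-, h3, -, -, h4, h5⟩ := h.apply i
  have h6 := h.s₁_nonneg i
  have h7 := h.s₂_nonneg i
  rcases hβ.lt_or_gt with hβ | hβ
  · have hs : 0 < w.s₂ i := by linarith
    have hν : w.ν₂ i = 0 := (_root_.mul_eq_zero.1 h2).resolve_left hs.ne'
    have hν' : 0 < w.ν₁ i := by linarith
    exact .inr ⟨hs, (_root_.mul_eq_zero.1 h1).resolve_right hν'.ne', hν'⟩
  · have hs : 0 < w.s₁ i := by linarith
    have hν : w.ν₁ i = 0 := (_root_.mul_eq_zero.1 h1).resolve_left hs.ne'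
    have hν' : 0 < w.ν₂ i := by linarith
    exact .inl ⟨hs, (_root_.mul_eq_zero.1 h2).resolve_right hν'.ne', hν'⟩

lemma IsKKT.inactive {M : Matrix (Fin m) (Fin n) ℝ} {b : Fin m → ℝ} {lam : ℝ} (hlam : 0 < lam)
    {w : Iterate n} (h : IsKKT M b lam w) (hSC : StrictComplementarity w) {i : Fin n}
    (hi : i ∉ activeSet w.β) :
    w.β i = 0 ∧ w.z i = 0 ∧ w.s₁ i = 0 ∧ w.s₂ i = 0 ∧ 0 < w.ν₁ i ∧ 0 < w.ν₂ i := by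
  have hβ : w.β i = 0 := by simpa [activeSet] using hi
  obtain ⟨h1, h2⟩ := h.mul_eq_zero i
  obtain ⟨-, h3, -, -, h4, h5⟩ := h.apply i
  obtain ⟨h6, h7⟩ := hSC i
  have hz : w.z i = 0 := by
    by_contra hz
    have h8 : w.ν₁ i = 0 := (_root_.mul_eq_zero.1 h1).resolve_left (by rw [h4, hβ, add_zero]; exact hz)
    have h9 : w.ν₂ i = 0 := (_root_.mul_eq_zero.1 h2).resolve_left (by rw [h5, hβ, sub_zero]; exact hz)
    linarith
  rw [hβ, hz] at h4 h5
  exact ⟨hβ, hz, by linarith, by linarith, by linarith, by linarith⟩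

/-- The `ℓ¹` distance between the primal parts of two iterates. -/
def primalDist (w v : Iterate n) : ℝ :=
  ∑ i, (|w.β i - v.β i| + |w.z i - v.z i| + |w.s₁ i - v.s₁ i| + |w.s₂ i - v.s₂ i|)

lemma primalDist_nonneg (w v : Iterate n) : 0 ≤ primalDist w v :=
  Finset.sum_nonneg fun i _ => by positivity

/-- The sum of the fitting error and of the cross complementarity products of two iterates. -/
def complGap (M : Matrix (Fin m) (Fin n) ℝ) (w v : Iterate n) : ℝ :=
  (M *ᵥ (w.β - v.β)) ⬝ᵥ (M *ᵥ (w.β - v.β)) +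
    ∑ i, (v.s₁ i * w.ν₁ i + v.s₂ i * w.ν₂ i + w.s₁ i * v.ν₁ i + w.s₂ i * v.ν₂ i)

lemma complGap_eq {M : Matrix (Fin m) (Fin n) ℝ} {b : Fin m → ℝ} {lam : ℝ} {v : Iterate n}
    (hv : IsKKT M b lam v) (w : Iterate n) :
    complGap M w v = ∑ i, (w.s₁ i * w.ν₁ i + w.s₂ i * w.ν₂ i +
      ((w.β i - v.β i) * ((Mᵀ *ᵥ (M *ᵥ w.β - b)) i - w.y₁ i + w.y₂ i) +
      (w.z i - v.z i) * (lam - w.y₁ i - w.y₂ i) +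
      (w.s₁ i - v.s₁ i) * (w.y₁ i - w.ν₁ i) + (w.s₂ i - v.s₂ i) * (w.y₂ i - w.ν₂ i) +
      (w.y₁ i - v.y₁ i) * (w.z i + w.β i - w.s₁ i) +
      (w.y₂ i - v.y₂ i) * (w.z i - w.β i - w.s₂ i))) := by
  have hq : (M *ᵥ (w.β - v.β)) ⬝ᵥ (M *ᵥ (w.β - v.β)) = ∑ i, (w.β i - v.β i) *
      ((Mᵀ *ᵥ (M *ᵥ w.β - b)) i - (Mᵀ *ᵥ (M *ᵥ v.β - b)) i) := by
    rw [← vecMul_transpose, ← dotProduct_mulVec, vecMul_transpose]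
    refine Finset.sum_congr rfl fun i _ => ?_
    rw [← Pi.sub_apply (Mᵀ *ᵥ _), ← mulVec_sub, sub_sub_sub_cancel_right, mulVec_sub]
    rfl
  rw [complGap, hq, ← Finset.sum_add_distrib]
  refine Finset.sum_congr rfl fun i _ => ?_
  obtain ⟨h1, h2⟩ := hv.mul_eq_zero i
  obtain ⟨h3, h4, h5, h6, h7, h8⟩ := hv.apply i
  rw [h5, h6] at h3 ⊢
  have h9 : (Mᵀ *ᵥ (M *ᵥ v.β - b)) i = v.ν₁ i - v.ν₂ i := by linarith
  rw [h7] at h1 ⊢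
  rw [h8] at h2 ⊢
  rw [h9, ← h4]
  linear_combination h1 + h2

lemma complGap_le {M : Matrix (Fin m) (Fin n) ℝ} {b : Fin m → ℝ} {lam C γ : ℝ} (hC : 0 < C)
    (hlam : 0 < lam) {v : Iterate n} (hv : IsKKT M b lam v) :
    ∃ B, 0 ≤ B ∧ ∀ w ∈ centralNbhd M b lam C γ, 0 < dualityMeasure w → dualityMeasure w ≤ 1 →
      complGap M w v ≤ B * (dualityMeasure w * (1 + primalDist w v)) := by
  set Y := 2 * lam + 4 * C with hY
  refine ⟨2 * n + C + n * (2 * C * Y), by positivity, fun w hw hμ0 hμ1 => ?_⟩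
  set μ := dualityMeasure w with hμ
  have hX := primalDist_nonneg w v
  have hn : (n : ℝ) ≠ 0 := by
    intro h
    simp [hμ, dualityMeasure, h] at hμ0
  have hsum : ∑ i, (w.s₁ i * w.ν₁ i + w.s₂ i * w.ν₂ i) = 2 * n * μ := by
    rw [hμ, dualityMeasure, mul_div_cancel₀ _ (by simpa using hn), dotProduct, dotProduct,
      ← Finset.sum_add_distrib]
    exact Finset.sum_congr rfl fun i _ => by ring
  have hCμ : C * μ ≤ C := by nlinarith
  have hterm : ∀ i, (w.β i - v.β i) * ((Mᵀ *ᵥ (M *ᵥ w.β - b)) i - w.y₁ i + w.y₂ i) +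
      (w.z i - v.z i) * (lam - w.y₁ i - w.y₂ i) +
      (w.s₁ i - v.s₁ i) * (w.y₁ i - w.ν₁ i) + (w.s₂ i - v.s₂ i) * (w.y₂ i - w.ν₂ i) +
      (w.y₁ i - v.y₁ i) * (w.z i + w.β i - w.s₁ i) +
      (w.y₂ i - v.y₂ i) * (w.z i - w.β i - w.s₂ i) ≤
      C * μ * (|w.β i - v.β i| + |w.z i - v.z i| + |w.s₁ i - v.s₁ i| + |w.s₂ i - v.s₂ i|)
        + 2 * C * Y * μ := by
    intro i
    obtain ⟨h1, h2, h3, h4, h5, h6⟩ := residual_bounds hw i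
    obtain ⟨-, g2, g3, g4, -, -⟩ := hv.apply i
    have g5 := hv.ν₁_nonneg i
    have g6 := hv.ν₂_nonneg i
    obtain ⟨-, -, p3, p4⟩ := hw.2.2.2.1 i
    have key : ∀ a r R : ℝ, |a| ≤ R → |r| ≤ C * μ → a * r ≤ C * μ * R := fun a r R ha hr =>
      calc a * r ≤ |a| * |r| := by rw [← abs_mul]; exact le_abs_self _
        _ ≤ R * (C * μ) := by gcongr; exact (abs_nonneg a).trans ha
        _ = _ := by ring
    have k1 := key (w.β i - v.β i) _ _ le_rfl h1
    have k2 := key (w.z i - v.z i) _ _ le_rfl h2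
    have k3 := key (w.s₁ i - v.s₁ i) _ _ le_rfl h3
    have k4 := key (w.s₂ i - v.s₂ i) _ _ le_rfl h4
    have a2 := abs_le.1 h2
    have a3 := abs_le.1 h3
    have a4 := abs_le.1 h4
    have hy1 : |w.y₁ i - v.y₁ i| ≤ Y := by
      rw [abs_le, hY]; constructor <;> linarith
    have hy2 : |w.y₂ i - v.y₂ i| ≤ Y := by
      rw [abs_le, hY]; constructor <;> linarith
    have k5 := key _ _ _ hy1 h5
    have k6 := key _ _ _ hy2 h6
    linarith
  rw [complGap_eq hv, Finset.sum_add_distrib, hsum]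
  have h7 := (Finset.sum_le_sum fun i (_ : i ∈ Finset.univ) => hterm i).trans_eq
    (c := C * μ * primalDist w v + n * (2 * C * Y * μ)) (by
      rw [Finset.sum_add_distrib, ← Finset.mul_sum, Finset.sum_const, Finset.card_univ,
        Fintype.card_fin, nsmul_eq_mul, primalDist])
  have h8 : 0 ≤ 2 * n * (μ * primalDist w v) := by positivity
  have h9 : 0 ≤ n * (2 * C * Y) * (μ * primalDist w v) := by positivity
  have h10 : 0 ≤ C * μ := by positivity
  linarith

end Convergence

section Limits

open Asymptotics

variable {m n : ℕ} {M : Matrix (Fin m) (Fin n) ℝ} {b : Fin m → ℝ} {lam C γ : ℝ} {v : Iterate n}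

/-- The filter of the iterates in the central neighborhood whose duality measure tends to zero. -/
def centralFilter (M : Matrix (Fin m) (Fin n) ℝ) (b : Fin m → ℝ) (lam C γ : ℝ) :
    Filter (Iterate n) :=
  comap dualityMeasure (𝓝[>] 0) ⊓ 𝓟 (centralNbhd M b lam C γ)

lemma tendsto_dualityMeasure : Tendsto dualityMeasure (centralFilter M b lam C γ) (𝓝[>] 0) :=
  tendsto_comap.mono_left inf_le_left

lemma eventually_mem_centralNbhd :
    ∀ᶠ w in centralFilter M b lam C γ, w ∈ centralNbhd M b lam C γ :=
  mem_inf_of_right (mem_principal_self _)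

lemma one_isBigO_one_add_primalDist {F : Filter (Iterate n)} :
    (fun _ => (1 : ℝ)) =O[F] fun w => 1 + primalDist w v :=
  .of_norm_le fun w => by
    rw [norm_one]
    linarith [primalDist_nonneg w v]

lemma mul_dualityMeasure_isLittleO :
    (fun w => C * dualityMeasure w) =o[centralFilter M b lam C γ]
      fun w => 1 + primalDist w v := by
  refine IsLittleO.trans_isBigO ((isLittleO_one_iff ℝ).2 ?_) one_isBigO_one_add_primalDist
  simpa using (tendsto_dualityMeasure.mono_right nhdsWithin_le_nhds).const_mul C

lemma isLittleO_of_abs_le {α : Type*} {F : Filter α} {f h g : α → ℝ} (hh : h =o[F] g)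
    (hfh : ∀ᶠ w in F, |f w| ≤ h w) : f =o[F] g :=
  (IsBigO.of_bound 1 (hfh.mono fun w hw => by
    simpa using hw.trans (le_abs_self _))).trans_isLittleO hh

lemma complGap_terms_nonneg (hv : IsKKT M b lam v) {w : Iterate n}
    (hw : w ∈ centralNbhd M b lam C γ) (i : Fin n) :
    0 ≤ v.s₁ i * w.ν₁ i ∧ 0 ≤ v.s₂ i * w.ν₂ i ∧ 0 ≤ w.s₁ i * v.ν₁ i ∧ 0 ≤ w.s₂ i * v.ν₂ i := by
  obtain ⟨h1, h2, h3, h4⟩ := hw.2.2.2.1 i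
  exact ⟨mul_nonneg (hv.s₁_nonneg i) h3.le, mul_nonneg (hv.s₂_nonneg i) h4.le,
    mul_nonneg h1.le (hv.ν₁_nonneg i), mul_nonneg h2.le (hv.ν₂_nonneg i)⟩

lemma complGap_bounds (hv : IsKKT M b lam v) {w : Iterate n}
    (hw : w ∈ centralNbhd M b lam C γ) :
    0 ≤ complGap M w v ∧ (∀ k, (M *ᵥ (w.β - v.β)) k ^ 2 ≤ complGap M w v) ∧
    ∀ i, v.s₁ i * w.ν₁ i ≤ complGap M w v ∧ v.s₂ i * w.ν₂ i ≤ complGap M w v ∧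
      w.s₁ i * v.ν₁ i ≤ complGap M w v ∧ w.s₂ i * v.ν₂ i ≤ complGap M w v := by
  have hterm : ∀ i, 0 ≤ v.s₁ i * w.ν₁ i + v.s₂ i * w.ν₂ i + w.s₁ i * v.ν₁ i + w.s₂ i * v.ν₂ i :=
    fun i => by
      obtain ⟨h1, h2, h3, h4⟩ := complGap_terms_nonneg hv hw i
      positivity
  have hsum := Finset.sum_nonneg fun i (_ : i ∈ Finset.univ) => hterm i
  have hsq : 0 ≤ (M *ᵥ (w.β - v.β)) ⬝ᵥ (M *ᵥ (w.β - v.β)) :=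
    Finset.sum_nonneg fun i _ => mul_self_nonneg _
  refine ⟨add_nonneg hsq hsum, fun k => ?_, fun i => ?_⟩
  · have h := Finset.single_le_sum (f := fun k => (M *ᵥ (w.β - v.β)) k * (M *ᵥ (w.β - v.β)) k)
      (fun k _ => mul_self_nonneg _) (Finset.mem_univ k)
    change _ ≤ (M *ᵥ (w.β - v.β)) ⬝ᵥ (M *ᵥ (w.β - v.β)) at h
    rw [complGap, sq]
    linarith
  · have h := Finset.single_le_sum (f := fun i => v.s₁ i * w.ν₁ i + v.s₂ i * w.ν₂ i +
      w.s₁ i * v.ν₁ i + w.s₂ i * v.ν₂ i) (fun i _ => hterm i) (Finset.mem_univ i)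
    obtain ⟨h1, h2, h3, h4⟩ := complGap_terms_nonneg hv hw i
    rw [complGap]
    refine ⟨?_, ?_, ?_, ?_⟩ <;> linarith

lemma complGap_isLittleO (hC : 0 < C) (hlam : 0 < lam) (hv : IsKKT M b lam v) :
    (fun w => complGap M w v) =o[centralFilter M b lam C γ] fun w => 1 + primalDist w v := by
  obtain ⟨B, hB0, hB⟩ := complGap_le (γ := γ) hC hlam hv
  have hμ : dualityMeasure =o[centralFilter M b lam C γ] fun _ => (1 : ℝ) :=
    (isLittleO_one_iff ℝ).2 (tendsto_dualityMeasure.mono_right nhdsWithin_le_nhds)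
  have h := (hμ.mul_isBigO (isBigO_refl (fun w => 1 + primalDist w v) _)).const_mul_left B
  simp only [one_mul] at h
  refine isLittleO_of_abs_le h ?_
  have hpos : ∀ᶠ w in centralFilter M b lam C γ, 0 < dualityMeasure w :=
    tendsto_dualityMeasure.eventually self_mem_nhdsWithin
  have hle : ∀ᶠ w in centralFilter M b lam C γ, dualityMeasure w ≤ 1 :=
    (tendsto_dualityMeasure.mono_right nhdsWithin_le_nhds).eventually_le_const one_pos
  filter_upwards [eventually_mem_centralNbhd, hpos, hle] with w hw h0 h1
  rw [abs_of_nonneg (complGap_bounds hv hw).1]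
  exact hB w hw h0 h1

lemma isLittleO_of_mul_le_complGap (hC : 0 < C) (hlam : 0 < lam) (hv : IsKKT M b lam v)
    {f : Iterate n → ℝ} {c : ℝ} (hc : 0 < c)
    (hf : ∀ w ∈ centralNbhd M b lam C γ, 0 < f w ∧ f w * c ≤ complGap M w v) :
    f =o[centralFilter M b lam C γ] fun w => 1 + primalDist w v := by
  refine isLittleO_of_abs_le ((complGap_isLittleO hC hlam hv).const_mul_left c⁻¹) ?_
  filter_upwards [eventually_mem_centralNbhd] with w hw
  obtain ⟨h1, h2⟩ := hf w hw
  rw [abs_of_pos h1, inv_mul_eq_div, le_div_iff₀ hc]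
  exact h2

lemma mulVec_sub_isLittleO (hC : 0 < C) (hlam : 0 < lam) (hv : IsKKT M b lam v) (k : Fin m) :
    (fun w => (M *ᵥ (w.β - v.β)) k) =o[centralFilter M b lam C γ] fun w => 1 + primalDist w v := by
  refine IsLittleO.of_pow (n := 2) ?_ two_ne_zero
  refine isLittleO_of_abs_le (h := fun w => complGap M w v) ?_ ?_
  · refine (complGap_isLittleO hC hlam hv).trans_isBigO (.of_norm_le fun w => ?_)
    have := primalDist_nonneg w v
    simp only [Pi.pow_apply]
    rw [Real.norm_of_nonneg (by linarith)]
    nlinarith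
  · filter_upwards [eventually_mem_centralNbhd] with w hw
    simp only [Pi.pow_apply]
    rw [abs_of_nonneg (sq_nonneg _)]
    exact (complGap_bounds hv hw).2.1 k

lemma residual_isLittleO :
    (∀ i, (fun w => (Mᵀ *ᵥ (M *ᵥ w.β - b)) i - w.y₁ i + w.y₂ i) =o[centralFilter M b lam C γ]
      fun w => 1 + primalDist w v) ∧
    (∀ i, (fun w => lam - w.y₁ i - w.y₂ i) =o[centralFilter M b lam C γ]
      fun w => 1 + primalDist w v) ∧
    (∀ i, (fun w => w.y₁ i - w.ν₁ i) =o[centralFilter M b lam C γ]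
      fun w => 1 + primalDist w v) ∧
    (∀ i, (fun w => w.y₂ i - w.ν₂ i) =o[centralFilter M b lam C γ]
      fun w => 1 + primalDist w v) ∧
    (∀ i, (fun w => w.z i + w.β i - w.s₁ i) =o[centralFilter M b lam C γ]
      fun w => 1 + primalDist w v) ∧
    (∀ i, (fun w => w.z i - w.β i - w.s₂ i) =o[centralFilter M b lam C γ]
      fun w => 1 + primalDist w v) := by
  have h := fun i => (eventually_mem_centralNbhd (M := M) (b := b) (lam := lam) (C := C)
    (γ := γ)).mono fun w hw => residual_bounds hw i
  have ho := mul_dualityMeasure_isLittleO (M := M) (b := b) (lam := lam) (C := C) (γ := γ) (v := v)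
  exact ⟨fun i => isLittleO_of_abs_le ho ((h i).mono fun w hw => hw.1),
    fun i => isLittleO_of_abs_le ho ((h i).mono fun w hw => hw.2.1),
    fun i => isLittleO_of_abs_le ho ((h i).mono fun w hw => hw.2.2.1),
    fun i => isLittleO_of_abs_le ho ((h i).mono fun w hw => hw.2.2.2.1),
    fun i => isLittleO_of_abs_le ho ((h i).mono fun w hw => hw.2.2.2.2.1),
    fun i => isLittleO_of_abs_le ho ((h i).mono fun w hw => hw.2.2.2.2.2)⟩

lemma slack_isLittleO (hC : 0 < C) (hlam : 0 < lam) (hv : IsKKT M b lam v) (i : Fin n) :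
    (0 < v.ν₁ i → (fun w => w.s₁ i) =o[centralFilter M b lam C γ] fun w => 1 + primalDist w v) ∧
    (0 < v.ν₂ i → (fun w => w.s₂ i) =o[centralFilter M b lam C γ] fun w => 1 + primalDist w v) :=
  ⟨fun h => isLittleO_of_mul_le_complGap hC hlam hv h fun _ hw =>
      ⟨(hw.2.2.2.1 i).1, ((complGap_bounds hv hw).2.2 i).2.2.1⟩,
    fun h => isLittleO_of_mul_le_complGap hC hlam hv h fun _ hw =>
      ⟨(hw.2.2.2.1 i).2.1, ((complGap_bounds hv hw).2.2 i).2.2.2⟩⟩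

lemma inactive_isLittleO (hC : 0 < C) (hlam : 0 < lam) (hv : IsKKT M b lam v)
    (hSC : StrictComplementarity v) {i : Fin n} (hi : i ∉ activeSet v.β) :
    (fun w => w.β i - v.β i) =o[centralFilter M b lam C γ] (fun w => 1 + primalDist w v) ∧
    (fun w => w.z i - v.z i) =o[centralFilter M b lam C γ] (fun w => 1 + primalDist w v) ∧
    (fun w => w.s₁ i - v.s₁ i) =o[centralFilter M b lam C γ] (fun w => 1 + primalDist w v) ∧
    (fun w => w.s₂ i - v.s₂ i) =o[centralFilter M b lam C γ] (fun w => 1 + primalDist w v) := by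
  obtain ⟨hβ, hz, hs1, hs2, hν1, hν2⟩ := hv.inactive hlam hSC hi
  obtain ⟨-, -, -, -, p1, p2⟩ := residual_isLittleO (M := M) (b := b) (lam := lam) (C := C)
    (γ := γ) (v := v)
  have h1 := (slack_isLittleO (C := C) (γ := γ) hC hlam hv i).1 hν1
  have h2 := (slack_isLittleO (C := C) (γ := γ) hC hlam hv i).2 hν2
  simp only [hβ, hz, hs1, hs2, sub_zero]
  refine ⟨?_, ?_, h1, h2⟩
  · refine (((h1.sub h2).add ((p1 i).sub (p2 i))).const_mul_left 2⁻¹).congr_left fun w => ?_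
    ring
  · refine (((h1.add h2).add ((p1 i).add (p2 i))).const_mul_left 2⁻¹).congr_left fun w => ?_
    ring

lemma active_β_isLittleO (hC : 0 < C) (hlam : 0 < lam) (hv : IsKKT M b lam v)
    (hSC : StrictComplementarity v) {l : ℝ} (hl : 0 < l)
    (hM : ∀ x : Fin n → ℝ, (∀ i, i ∉ activeSet v.β → x i = 0) →
      l * (x ⬝ᵥ x) ≤ (M *ᵥ x) ⬝ᵥ (M *ᵥ x)) {i : Fin n} (hi : i ∈ activeSet v.β) :
    (fun w => w.β i - v.β i) =o[centralFilter M b lam C γ] fun w => 1 + primalDist w v := by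
  set u : Iterate n → Fin n → ℝ := fun w j => if j ∈ activeSet v.β then w.β j - v.β j else 0
    with hu
  have hMu : ∀ k, (fun w => (M *ᵥ u w) k) =o[centralFilter M b lam C γ]
      fun w => 1 + primalDist w v := by
    intro k
    have h1 : (fun w => ∑ j, M k j * (if j ∈ activeSet v.β then 0 else w.β j - v.β j))
        =o[centralFilter M b lam C γ] fun w => 1 + primalDist w v := by
      refine IsLittleO.fun_sum fun j _ => IsLittleO.const_mul_left ?_ _
      by_cases hj : j ∈ activeSet v.β
      · simp [hj]
      · simpa [hj] using (inactive_isLittleO hC hlam hv hSC hj).1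
    refine ((mulVec_sub_isLittleO hC hlam hv k).sub h1).congr_left fun w => ?_
    simp only [mulVec, dotProduct, ← Finset.sum_sub_distrib, hu]
    refine Finset.sum_congr rfl fun j _ => ?_
    by_cases hj : j ∈ activeSet v.β <;> simp [hj]
  have hsq : (fun w => l⁻¹ * ∑ k, (M *ᵥ u w) k ^ 2) =o[centralFilter M b lam C γ]
      fun w => (1 + primalDist w v) ^ 2 :=
    (IsLittleO.fun_sum fun k _ => (hMu k).pow two_pos).const_mul_left _
  refine IsLittleO.of_pow (n := 2) (isLittleO_of_abs_le hsq (.of_forall fun w => ?_)) two_ne_zero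
  simp only [Pi.pow_apply]
  rw [abs_of_nonneg (sq_nonneg _), inv_mul_eq_div, le_div_iff₀ hl]
  have h1 := hM (u w) fun j hj => if_neg hj
  have h2 := Finset.single_le_sum (f := fun j => u w j * u w j)
    (fun j _ => mul_self_nonneg _) (Finset.mem_univ i)
  change _ ≤ u w ⬝ᵥ u w at h2
  simp only [hu, if_pos hi] at h2
  calc (w.β i - v.β i) ^ 2 * l ≤ l * (u w ⬝ᵥ u w) := by
        rw [mul_comm, sq]; exact mul_le_mul_of_nonneg_left h2 hl.le
    _ ≤ _ := h1
    _ = _ := by simp only [dotProduct, sq]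

lemma active_isLittleO (hC : 0 < C) (hlam : 0 < lam) (hv : IsKKT M b lam v) {i : Fin n}
    (hi : i ∈ activeSet v.β) (hβ : (fun w => w.β i - v.β i) =o[centralFilter M b lam C γ]
      fun w => 1 + primalDist w v) :
    (fun w => w.z i - v.z i) =o[centralFilter M b lam C γ] (fun w => 1 + primalDist w v) ∧
    (fun w => w.s₁ i - v.s₁ i) =o[centralFilter M b lam C γ] (fun w => 1 + primalDist w v) ∧
    (fun w => w.s₂ i - v.s₂ i) =o[centralFilter M b lam C γ] (fun w => 1 + primalDist w v) := by
  obtain ⟨-, -, -, -, p1, p2⟩ := residual_isLittleO (M := M) (b := b) (lam := lam) (C := C)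
    (γ := γ) (v := v)
  obtain ⟨-, -, -, -, g1, g2⟩ := hv.apply i
  obtain ⟨h1, h2⟩ := slack_isLittleO (C := C) (γ := γ) hC hlam hv i
  rcases hv.active hlam hi with ⟨-, hs, hν⟩ | ⟨-, hs, hν⟩
  · have hz : (fun w => w.z i - v.z i) =o[centralFilter M b lam C γ]
        fun w => 1 + primalDist w v :=
      ((hβ.add (h2 hν)).add (p2 i)).congr_left fun w => by linarith
    exact ⟨hz, ((hz.add hβ).sub (p1 i)).congr_left fun w => by linarith,
      (h2 hν).congr_left fun w => by rw [hs, sub_zero]⟩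
  · have hz : (fun w => w.z i - v.z i) =o[centralFilter M b lam C γ]
        fun w => 1 + primalDist w v :=
      (((h1 hν).sub hβ).add (p1 i)).congr_left fun w => by linarith
    exact ⟨hz, (h1 hν).congr_left fun w => by rw [hs, sub_zero],
      ((hz.sub hβ).sub (p2 i)).congr_left fun w => by linarith⟩

lemma tendsto_zero_of_isLittleO_one_add {α : Type*} {F : Filter α} {f : α → ℝ} (hf : ∀ w, 0 ≤ f w)
    (h : f =o[F] fun w => 1 + f w) : Tendsto f F (𝓝 0) := by
  rw [← isLittleO_one_iff ℝ]
  refine h.trans_isBigO (IsBigO.of_bound 2 ?_)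
  filter_upwards [h.def (half_pos one_pos)] with w hw
  have := hf w
  rw [Real.norm_of_nonneg (by linarith), Real.norm_of_nonneg (by linarith)] at hw
  rw [Real.norm_of_nonneg (by linarith), norm_one]
  linarith

/-- The primal parts of the iterates converge to the solution as the duality measure vanishes. -/
lemma tendsto_primalDist (hC : 0 < C) (hlam : 0 < lam) (hv : IsKKT M b lam v)
    (hSC : StrictComplementarity v) {l : ℝ} (hl : 0 < l)
    (hM : ∀ x : Fin n → ℝ, (∀ i, i ∉ activeSet v.β → x i = 0) →
      l * (x ⬝ᵥ x) ≤ (M *ᵥ x) ⬝ᵥ (M *ᵥ x)) :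
    Tendsto (fun w => primalDist w v) (centralFilter M b lam C γ) (𝓝 0) := by
  refine tendsto_zero_of_isLittleO_one_add (fun w => primalDist_nonneg w v) ?_
  refine IsLittleO.fun_sum fun i _ => ?_
  obtain ⟨h1, h2, h3, h4⟩ : (fun w => w.β i - v.β i) =o[centralFilter M b lam C γ]
        (fun w => 1 + primalDist w v) ∧
      (fun w => w.z i - v.z i) =o[centralFilter M b lam C γ] (fun w => 1 + primalDist w v) ∧
      (fun w => w.s₁ i - v.s₁ i) =o[centralFilter M b lam C γ] (fun w => 1 + primalDist w v) ∧
      (fun w => w.s₂ i - v.s₂ i) =o[centralFilter M b lam C γ] (fun w => 1 + primalDist w v) := by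
    by_cases hi : i ∈ activeSet v.β
    · have h := active_β_isLittleO (C := C) (γ := γ) hC hlam hv hSC hl hM hi
      exact ⟨h, active_isLittleO hC hlam hv hi h⟩
    · exact inactive_isLittleO hC hlam hv hSC hi
  exact ((h1.norm_left.add h2.norm_left).add h3.norm_left).add h4.norm_left

end Limits

section SchurLimits

open Asymptotics

variable {m n : ℕ} {M : Matrix (Fin m) (Fin n) ℝ} {b : Fin m → ℝ} {lam C γ : ℝ} {v : Iterate n}

lemma isLittleO_one_of_tendsto {F : Filter (Iterate n)}
    (hX : Tendsto (fun w => primalDist w v) F (𝓝 0)) {f : Iterate n → ℝ}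
    (hf : f =o[F] fun w => 1 + primalDist w v) : Tendsto f F (𝓝 0) :=
  (isLittleO_one_iff ℝ).1 (hf.trans_isBigO ((hX.const_add 1).isBigO_one ℝ))

lemma tendsto_coord {F : Filter (Iterate n)} (hX : Tendsto (fun w => primalDist w v) F (𝓝 0))
    (i : Fin n) :
    Tendsto (fun w => w.β i) F (𝓝 (v.β i)) ∧ Tendsto (fun w => w.s₁ i) F (𝓝 (v.s₁ i)) ∧
      Tendsto (fun w => w.s₂ i) F (𝓝 (v.s₂ i)) := by
  have h : ∀ w, |w.β i - v.β i| + |w.z i - v.z i| + |w.s₁ i - v.s₁ i| + |w.s₂ i - v.s₂ i|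
      ≤ primalDist w v := fun w =>
    Finset.single_le_sum (f := fun i => |w.β i - v.β i| + |w.z i - v.z i| + |w.s₁ i - v.s₁ i| +
      |w.s₂ i - v.s₂ i|) (fun i _ => by positivity) (Finset.mem_univ i)
  refine ⟨?_, ?_, ?_⟩ <;> rw [tendsto_iff_norm_sub_tendsto_zero] <;>
    refine squeeze_zero (fun _ => norm_nonneg _) (fun w => ?_) hX <;> rw [Real.norm_eq_abs] <;>
    linarith [h w, abs_nonneg (w.β i - v.β i), abs_nonneg (w.z i - v.z i),
      abs_nonneg (w.s₁ i - v.s₁ i), abs_nonneg (w.s₂ i - v.s₂ i)]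

lemma tendsto_schurDiag_active (hC : 0 < C) (hlam : 0 < lam) (hv : IsKKT M b lam v)
    (hX : Tendsto (fun w => primalDist w v) (centralFilter M b lam C γ) (𝓝 0)) {i : Fin n}
    (hi : i ∈ activeSet v.β) :
    Tendsto (fun w => schurDiag w i) (centralFilter M b lam C γ) (𝓝 0) := by
  have hpos := eventually_mem_centralNbhd.mono
    fun w (hw : w ∈ centralNbhd M b lam C γ) => hw.2.2.2.1 i
  obtain ⟨-, h1, h2⟩ := tendsto_coord hX i
  refine tendsto_const_nhds.div_atTop ?_
  rcases hv.active hlam hi with ⟨hs, -, -⟩ | ⟨hs, -, -⟩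
  · have hν : Tendsto (fun w => w.ν₁ i) (centralFilter M b lam C γ) (𝓝[>] 0) :=
      tendsto_nhdsWithin_iff.2 ⟨isLittleO_one_of_tendsto hX
        (isLittleO_of_mul_le_complGap hC hlam hv hs fun w hw => ⟨(hw.2.2.2.1 i).2.2.1, by
          rw [mul_comm]; exact ((complGap_bounds hv hw).2.2 i).1⟩), hpos.mono fun w hw => hw.2.2.1⟩
    refine tendsto_atTop_mono' _ ?_ (h1.pos_mul_atTop hs (tendsto_inv_nhdsGT_zero.comp hν))
    filter_upwards [hpos] with w hw
    exact le_add_of_nonneg_right (div_pos hw.2.1 hw.2.2.2).le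
  · have hν : Tendsto (fun w => w.ν₂ i) (centralFilter M b lam C γ) (𝓝[>] 0) :=
      tendsto_nhdsWithin_iff.2 ⟨isLittleO_one_of_tendsto hX
        (isLittleO_of_mul_le_complGap hC hlam hv hs fun w hw => ⟨(hw.2.2.2.1 i).2.2.2, by
          rw [mul_comm]; exact ((complGap_bounds hv hw).2.2 i).2.1⟩),
        hpos.mono fun w hw => hw.2.2.2⟩
    refine tendsto_atTop_mono' _ ?_ (h2.pos_mul_atTop hs (tendsto_inv_nhdsGT_zero.comp hν))
    filter_upwards [hpos] with w hw
    exact le_add_of_nonneg_left (div_pos hw.1 hw.2.2.1).le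

lemma tendsto_multipliers (hv : IsKKT M b lam v)
    (hX : Tendsto (fun w => primalDist w v) (centralFilter M b lam C γ) (𝓝 0)) (i : Fin n) :
    Tendsto (fun w => w.ν₁ i) (centralFilter M b lam C γ) (𝓝 (v.ν₁ i)) ∧
      Tendsto (fun w => w.ν₂ i) (centralFilter M b lam C γ) (𝓝 (v.ν₂ i)) := by
  obtain ⟨r1, r2, r3, r4, -, -⟩ := residual_isLittleO (M := M) (b := b) (lam := lam) (C := C)
    (γ := γ) (v := v)
  have t1 := isLittleO_one_of_tendsto hX (r1 i)
  have t2 := isLittleO_one_of_tendsto hX (r2 i)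
  have t3 := isLittleO_one_of_tendsto hX (r3 i)
  have t4 := isLittleO_one_of_tendsto hX (r4 i)
  have hβ : Tendsto (fun w : Iterate n => w.β) (centralFilter M b lam C γ) (𝓝 v.β) :=
    tendsto_pi_nhds.2 fun j => (tendsto_coord hX j).1
  have hcont : Continuous fun x : Fin n → ℝ => (Mᵀ *ᵥ (M *ᵥ x - b)) i := by fun_prop
  have hg := (hcont.tendsto v.β).comp hβ
  obtain ⟨h1, h2, h3, h4, -, -⟩ := hv.apply i
  have e1 := ((((tendsto_const_nhds (x := lam)).sub t2).add (hg.sub t1)).mul_const 2⁻¹).sub t3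
  have e2 := ((((tendsto_const_nhds (x := lam)).sub t2).sub (hg.sub t1)).mul_const 2⁻¹).sub t4
  constructor
  · convert e1 using 2
    · simp only [Function.comp]; ring
    · linarith
  · convert e2 using 2
    · simp only [Function.comp]; ring
    · linarith

lemma tendsto_schurDiag_inactive (hlam : 0 < lam) (hv : IsKKT M b lam v)
    (hSC : StrictComplementarity v)
    (hX : Tendsto (fun w => primalDist w v) (centralFilter M b lam C γ) (𝓝 0)) {i : Fin n}
    (hi : i ∉ activeSet v.β) :
    Tendsto (fun w => schurDiag w i) (centralFilter M b lam C γ) atTop := by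
  have hpos := eventually_mem_centralNbhd.mono
    fun w (hw : w ∈ centralNbhd M b lam C γ) => hw.2.2.2.1 i
  obtain ⟨-, h1, h2⟩ := tendsto_coord hX i
  obtain ⟨h3, h4⟩ := tendsto_multipliers hv hX i
  obtain ⟨-, -, hs1, hs2, hν1, hν2⟩ := hv.inactive hlam hSC hi
  have h5 := (h1.div h3 hν1.ne').add (h2.div h4 hν2.ne')
  rw [hs1, hs2, zero_div, zero_div, add_zero] at h5
  refine (tendsto_inv_nhdsGT_zero.comp (tendsto_nhdsWithin_iff.2 ⟨h5, ?_⟩)).const_mul_atTop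
    (by norm_num : (0 : ℝ) < 4)
  filter_upwards [hpos] with w hw using add_pos (div_pos hw.1 hw.2.2.1) (div_pos hw.2.1 hw.2.2.2)

end SchurLimits

section ConditionNumber

variable {m n : ℕ} {M : Matrix (Fin m) (Fin n) ℝ} {b : Fin m → ℝ} {lam C γ : ℝ} {v : Iterate n}

lemma tendsto_spectralCond_preconditionedKKT [NeZero n] (hC : 0 < C) (hlam : 0 < lam)
    (hv : IsKKT M b lam v) (hSC : StrictComplementarity v) {L l : ℝ} (hl0 : 0 < l)
    (hL : ∀ c, L ≤ c ↔ 1 ≤ c ∧ ∀ x : Fin n → ℝ, (∀ i, i ∉ activeSet v.β → x i = 0) →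
      (M *ᵥ x) ⬝ᵥ (M *ᵥ x) ≤ c * (x ⬝ᵥ x))
    (hl : ∀ c, c ≤ l ↔ c ≤ 1 ∧ ∀ x : Fin n → ℝ, (∀ i, i ∉ activeSet v.β → x i = 0) →
      c * (x ⬝ᵥ x) ≤ (M *ᵥ x) ⬝ᵥ (M *ᵥ x)) :
    Tendsto (fun w => spectralCond (preconditionedKKT M w)) (centralFilter M b lam C γ)
      (𝓝 (L / l)) := by
  have hX := tendsto_primalDist (C := C) (γ := γ) hC hlam hv hSC hl0 ((hl l).1 le_rfl).2
  have hF : ∀ᶠ w in centralFilter M b lam C γ, IsInterior w :=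
    eventually_mem_centralNbhd.mono fun w hw => hw.2.2.2.1
  have hA : ∀ i ∈ activeSet v.β, _ := fun i hi => tendsto_schurDiag_active hC hlam hv hX hi
  have hI : ∀ i, i ∉ activeSet v.β → _ := fun i hi => tendsto_schurDiag_inactive hlam hv hSC hX hi
  exact (tendsto_lambdaMax_preconditionedKKT M hF hA hI hL).div
    (tendsto_lambdaMin_preconditionedKKT M hF hA hI hl) hl0.ne'

lemma tendsto_spectralCond_of_nonempty [NeZero n] (hC : 0 < C) (hlam : 0 < lam)
    (hv : IsKKT M b lam v) (hSC : StrictComplementarity v) (hA : (activeSet v.β).Nonempty)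
    (hrank : (activeSubmatrix M v.β).rank = (activeSet v.β).card) :
    Tendsto (fun w => spectralCond (preconditionedKKT M w)) (centralFilter M b lam C γ)
      (𝓝 (max 1 (lambdaMax (activeGram M v.β)) / min 1 (lambdaMin (activeGram M v.β)))) :=
  tendsto_spectralCond_preconditionedKKT hC hlam hv hSC
    (lt_min one_pos (lambdaMin_activeGram_pos M hA hrank))
    (fun c => by rw [max_le_iff, lambdaMax_activeGram_le_iff M hA])
    (fun c => by rw [le_min_iff, le_lambdaMin_activeGram_iff M hA])

lemma tendsto_spectralCond_of_eq_empty [NeZero n] (hC : 0 < C) (hlam : 0 < lam)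
    (hv : IsKKT M b lam v) (hSC : StrictComplementarity v) (hA : activeSet v.β = ∅) :
    Tendsto (fun w => spectralCond (preconditionedKKT M w)) (centralFilter M b lam C γ) (𝓝 1) := by
  have hx : ∀ x : Fin n → ℝ, (∀ i, i ∉ activeSet v.β → x i = 0) → x = 0 := fun x hx =>
    funext fun i => hx i (by simp [hA])
  rw [← div_one (1 : ℝ)]
  refine tendsto_spectralCond_preconditionedKKT hC hlam hv hSC one_pos (fun c => ?_) fun c => ?_
  · refine ⟨fun h => ⟨h, fun x h0 => ?_⟩, And.left⟩
    simp [hx x h0]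
  · refine ⟨fun h => ⟨h, fun x h0 => ?_⟩, And.left⟩
    simp [hx x h0]

lemma dualityMeasure_pos [NeZero n] {w : Iterate n} (hw : IsInterior w) : 0 < dualityMeasure w := by
  have hn : (0 : ℝ) < n := Nat.cast_pos.2 (NeZero.pos n)
  refine div_pos (add_pos ?_ ?_) (by positivity)
  · exact Finset.sum_pos (fun i _ => mul_pos (hw i).2.2.1 (hw i).1) Finset.univ_nonempty
  · exact Finset.sum_pos (fun i _ => mul_pos (hw i).2.2.2 (hw i).2.1) Finset.univ_nonempty

lemma exists_bound_of_tendsto [NeZero n] {f : Iterate n → ℝ} {a : ℝ}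
    (hf : Tendsto f (centralFilter M b lam C γ) (𝓝 a)) :
    ∃ μbar > 0, ∃ B : ℝ, ∀ w ∈ centralNbhd M b lam C γ, dualityMeasure w ≤ μbar → f w ≤ B := by
  have h := hf.eventually_le_const (lt_add_one a)
  rw [centralFilter, eventually_inf_principal, eventually_comap] at h
  obtain ⟨μbar, hμ, h⟩ := (nhdsGT_basis (0 : ℝ)).eventually_iff.1 h
  exact ⟨μbar / 2, half_pos hμ, a + 1, fun w hw hle =>
    h ⟨dualityMeasure_pos hw.2.2.2.1, hle.trans_lt (half_lt_self hμ)⟩ w rfl hw⟩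

lemma exists_bound_of_slack_bound [NeZero n] (hγ : 0 < γ) {μbar : ℝ} (hμ : 0 < μbar) (R : ℝ) :
    ∃ B : ℝ, ∀ w ∈ centralNbhd M b lam C γ, μbar ≤ dualityMeasure w → euclNorm w.s₁ ≤ R →
      euclNorm w.s₂ ≤ R → spectralCond (preconditionedKKT M w) ≤ B := by
  have hT : 0 < (R ^ 2 + 1) / (γ * μbar) := by positivity
  obtain ⟨B, hB⟩ := spectralCond_le_of_le_schurDiag M
    (by positivity : 0 < 4 / (2 * ((R ^ 2 + 1) / (γ * μbar))))
  refine ⟨B, fun w hw hle h1 h2 => hB w hw.2.2.2.1 fun i => ?_⟩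
  obtain ⟨p1, p2, p3, p4⟩ := hw.2.2.2.1 i
  obtain ⟨c1, c2⟩ := hw.2.2.2.2 i
  have hγμ : γ * μbar ≤ γ * dualityMeasure w := by gcongr
  have key : ∀ s ν : ℝ, 0 < s → 0 < ν → s ≤ R → γ * μbar ≤ s * ν →
      s / ν ≤ (R ^ 2 + 1) / (γ * μbar) := by
    intro s ν hs hν hsR hsν
    calc s / ν = s ^ 2 / (s * ν) := by field_simp
      _ ≤ (R ^ 2 + 1) / (γ * μbar) := by
        gcongr
        nlinarith
  have k1 := key _ _ p1 p3 (((le_abs_self _).trans (abs_apply_le_euclNorm _ i)).trans h1)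
    (hγμ.trans c1)
  have k2 := key _ _ p2 p4 (((le_abs_self _).trans (abs_apply_le_euclNorm _ i)).trans h2)
    (hγμ.trans c2)
  have := div_pos p1 p3
  have := div_pos p2 p4
  unfold schurDiag
  gcongr
  linarith

lemma exists_bound_of_slack_le [NeZero n] (hγ : 0 < γ)
    (h : ∃ μbar > 0, ∃ B : ℝ, ∀ w ∈ centralNbhd M b lam C γ, dualityMeasure w ≤ μbar →
      spectralCond (preconditionedKKT M w) ≤ B) (R : ℝ) :
    ∃ B : ℝ, ∀ w ∈ centralNbhd M b lam C γ, euclNorm w.s₁ ≤ R → euclNorm w.s₂ ≤ R →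
      spectralCond (preconditionedKKT M w) ≤ B := by
  obtain ⟨μbar, hμ, B, hB⟩ := h
  obtain ⟨B', hB'⟩ := exists_bound_of_slack_bound (M := M) (b := b) (lam := lam) (C := C) hγ hμ R
  refine ⟨max B B', fun w hw h1 h2 => ?_⟩
  rcases le_total (dualityMeasure w) μbar with hle | hle
  · exact (hB w hw hle).trans (le_max_left _ _)
  · exact (hB' w hw hle h1 h2).trans (le_max_right _ _)

lemma spectralCond_of_isEmpty {ι : Type*} [Fintype ι] [DecidableEq ι] [IsEmpty ι]
    (A : Matrix ι ι ℝ) : spectralCond A = 0 := by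
  simp [spectralCond, lambdaMax]

lemma centralFilter_eq_bot (M : Matrix (Fin m) (Fin 0) ℝ) (b : Fin m → ℝ) (lam C γ : ℝ) :
    centralFilter M b lam C γ = ⊥ := by
  refine empty_mem_iff_bot.1 ?_
  have h : ∀ᶠ w in centralFilter M b lam C γ, 0 < dualityMeasure w :=
    tendsto_dualityMeasure.eventually self_mem_nhdsWithin
  filter_upwards [h] with w hw
  simp [dualityMeasure] at hw

end ConditionNumber

end CompressedSensing

end

theorem mainTheorem1 {m n : ℕ} (M : Matrix (Fin m) (Fin n) ℝ) (b : Fin m → ℝ)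
    (lam : ℝ) (hlam : 0 < lam)
    (wstar : CompressedSensing.Iterate n)
    (hKKT : CompressedSensing.IsKKT M b lam wstar)
    (hSC : CompressedSensing.StrictComplementarity wstar)
    (hrank : (CompressedSensing.activeSubmatrix M wstar.β).rank
      = (CompressedSensing.activeSet wstar.β).card)
    (C γ : ℝ) (hC : 0 < C) (hγ : γ ∈ Set.Ioo (0 : ℝ) 1) :
    -- all complex eigenvalues of `P⁻¹ K` are real and positive on the whole neighborhood
    (∀ w ∈ CompressedSensing.centralNbhd M b lam C γ,
      ∀ ζ ∈ spectrum ℂ ((CompressedSensing.preconditionedKKT M w).map Complex.ofReal),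
        ζ.im = 0 ∧ 0 < ζ.re) ∧
    -- the limit for `μ → 0` in the neighborhood, when the solution is nonzero
    ((CompressedSensing.activeSet wstar.β).Nonempty →
      Tendsto (fun w => CompressedSensing.spectralCond (CompressedSensing.preconditionedKKT M w))
        (comap CompressedSensing.dualityMeasure (𝓝[>] 0) ⊓
          𝓟 (CompressedSensing.centralNbhd M b lam C γ))
        (𝓝 (max 1 (CompressedSensing.lambdaMax (CompressedSensing.activeGram M wstar.β)) /
          min 1 (CompressedSensing.lambdaMin (CompressedSensing.activeGram M wstar.β))))) ∧
    -- the same when the solution is zero, so that the Gram matrix is the empty matrix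
    (CompressedSensing.activeSet wstar.β = ∅ →
      Tendsto (fun w => CompressedSensing.spectralCond (CompressedSensing.preconditionedKKT M w))
        (comap CompressedSensing.dualityMeasure (𝓝[>] 0) ⊓
          𝓟 (CompressedSensing.centralNbhd M b lam C γ))
        (𝓝 1)) ∧
    -- boundedness on the whole neighborhood for small `μ`
    (∃ μbar > 0, ∃ B : ℝ, ∀ w ∈ CompressedSensing.centralNbhd M b lam C γ,
      CompressedSensing.dualityMeasure w ≤ μbar →
        CompressedSensing.spectralCond (CompressedSensing.preconditionedKKT M w) ≤ B) ∧
    -- boundedness, for all `μ`, wherever the slacks stay bounded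
    (∀ R : ℝ, ∃ B : ℝ, ∀ w ∈ CompressedSensing.centralNbhd M b lam C γ,
      CompressedSensing.euclNorm w.s₁ ≤ R → CompressedSensing.euclNorm w.s₂ ≤ R →
        CompressedSensing.spectralCond (CompressedSensing.preconditionedKKT M w) ≤ B) := by
  have hpos : ∀ w ∈ CompressedSensing.centralNbhd M b lam C γ,
      ∀ ζ ∈ spectrum ℂ ((CompressedSensing.preconditionedKKT M w).map Complex.ofReal),
        ζ.im = 0 ∧ 0 < ζ.re := fun w hw ζ hζ =>
    CompressedSensing.spectrum_map_ofReal_pos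
      (CompressedSensing.posDef_preconditioner hw.2.2.2.1)
      (CompressedSensing.posDef_condensedKKT M hw.2.2.2.1) hζ
  rcases n.eq_zero_or_pos with rfl | hn
  · have hbot := CompressedSensing.centralFilter_eq_bot M b lam C γ
    rw [CompressedSensing.centralFilter] at hbot
    rw [hbot]
    exact ⟨hpos, fun _ => tendsto_bot, fun _ => tendsto_bot,
      ⟨1, one_pos, 0, fun w _ _ => (CompressedSensing.spectralCond_of_isEmpty _).le⟩,
      fun _ => ⟨0, fun w _ _ _ => (CompressedSensing.spectralCond_of_isEmpty _).le⟩⟩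
  · have : NeZero n := ⟨hn.ne'⟩
    have hbdd : ∃ μbar > 0, ∃ B : ℝ, ∀ w ∈ CompressedSensing.centralNbhd M b lam C γ,
        CompressedSensing.dualityMeasure w ≤ μbar →
          CompressedSensing.spectralCond (CompressedSensing.preconditionedKKT M w) ≤ B := by
      rcases (CompressedSensing.activeSet wstar.β).eq_empty_or_nonempty with hA | hA
      · exact CompressedSensing.exists_bound_of_tendsto
          (CompressedSensing.tendsto_spectralCond_of_eq_empty hC hlam hKKT hSC hA)
      · exact CompressedSensing.exists_bound_of_tendsto
          (CompressedSensing.tendsto_spectralCond_of_nonempty hC hlam hKKT hSC hA hrank)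
    exact ⟨hpos,
      fun hA => CompressedSensing.tendsto_spectralCond_of_nonempty hC hlam hKKT hSC hA hrank,
      fun hA => CompressedSensing.tendsto_spectralCond_of_eq_empty hC hlam hKKT hSC hA,
      hbdd, CompressedSensing.exists_bound_of_slack_le hγ.1 hbdd⟩
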